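/- Let $(X,d)$ be a complete separable metric space which is a length space, and let $Y\subset X$ be open with $\emptyset\neq Y\neq X$. **Definitions.** $\mathcal P^{sub}(Y)$ is the set of Borel measures $\mu$ on $Y$ with $\mu(Y)\le 1$. For $x,y\in X$ let $d^*(x,y)=\inf_{z\in X\setminus Y}[d(x,z)+d(z,y)]$. Charged probability measures are the pairs $\sigma=(\sigma^+,\sigma^-)$ of Borel measures on $X$ with $\sigma^+|_{X\setminus Y}=\sigma^-|_{X\setminus Y}$ and $\sigma^+(X)+\sigma^-(X)=1$; put $\sigma^0=\sigma^+-\sigma^-$ and $\bar\sigma=\sigma^++\sigma^-$. For $p\in[1,\infty)$ let $$\tilde W_p(\sigma,\tau)=\inf\Big\{\int d^p\,dq^{++}+\int (d^*)^p\,dq^{+-}+\int (d^*)^p\,dq^{-+}+\int d^p\,dq^{--}\Big\}^{1/p},$$ where the infimum is over all decompositions $q=q^{++}+q^{+-}+q^{-+}+q^{--}$ of couplings $q$ of $\bar\sigma,\bar\tau$ into measures on $X\times X$ such that, for $i,j\in\{+,-\}$, the first marginal of $q^{i+}+q^{i-}$ is $\sigma^i$ and the second marginal of $q^{+j}+q^{-j}$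 is $\tau^j$. (Alternatively, let the infimum run only over the canonical decompositions $dq^{ij}(x,y)=u^i(x)v^j(y)\,dq(x,y)$ with $\sigma^i=u^i\bar\sigma$, $\tau^j=v^j\bar\tau$; the theorem holds for either choice, made once throughout.) For $\mu,\nu\in\mathcal P^{sub}(Y)$ let $$W^0_p(\mu,\nu)=\inf\{\tilde W_p(\sigma,\tau):\ \sigma^0=\mu,\ \tau^0=\nu\},$$ $$\mathcal P^{sub}_p(Y)=\{\mu\in\mathcal P^{sub}(Y):\ W^0_p(\mu,\delta_y)<\infty\text{ for some }y\in Y\},$$ $$W^\flat_p(\mu,\nu)=\inf\Big\{\sum_{i=1}^n W^0_p(\eta_{i-1},\eta_i):\ n\in\mathbb N,\ \eta_i\in\mathcal P^{sub}_p(Y),\ \eta_0=\mu,\ \eta_n=\nu\Big\}.$$ $W^\sharp_p(\mu,\nu)$ is the infimum of the $W^\flat_p$-lengths $\sup\sum_i W^\flat_p(\eta_{s_{i-1}},\eta_{s_i})$ (the supremum over all partitions $0=s_0<\dots<s_n=1$) of all $W^\flat_p$-continuous curves $\eta:[0,1]\to\mathcal P^{sub}_p(Y)$ with $\eta_0=\mu$,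 $\eta_1=\nu$. On $Y'=Y\cup\{\partial\}$ let $d'$ be the shortcut metric given by $d'(x,\partial)=d'(\partial,x)=\inf_{z\in X\setminus Y}d(x,z)$, $d'(\partial,\partial)=0$ and $d'(x,y)=\min\{d(x,y),\,d'(x,\partial)+d'(y,\partial)\}$ for $x,y\in Y$. Finally $W'_p(\mu,\nu)$ is the $L^p$-Kantorovich-Wasserstein distance, with respect to $d'$, of the probability measures $\mu+(1-\mu(Y))\delta_\partial$ and $\nu+(1-\nu(Y))\delta_\partial$ on $Y'$. **Theorem.** (i) For all $\mu,\nu\in\mathcal P^{sub}_1(Y)$: $\;W^\flat_1(\mu,\nu)=W^\sharp_1(\mu,\nu)=W'_1(\mu,\nu)$. (ii) For all $p\in[1,\infty)$ and all $\mu,\nu\in\mathcal P^{sub}_p(Y)$: $\;W'_1(\mu,\nu)\le W^\flat_p(\mu,\nu)\le W^\sharp_p(\mu,\nu)\le W'_p(\mu,\nu)$. -/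

import Mathlib

open MeasureTheory Set Filter Topology
open scoped ENNReal

/-- `X` is a length space: the distance of two points is the infimum of the lengths of the
continuous curves joining them (the length of a curve is its total variation). -/
def IsLengthSpace (X : Type*) [MetricSpace X] : Prop :=
  ∀ x y : X, edist x y = ⨅ γ : Path x y, eVariationOn (fun t : unitInterval => γ t) univ

/-- `q` is a coupling of `μ` and `ν`. -/
def IsCoupling {A : Type*} [MeasurableSpace A] (μ ν : Measure A) (q : Measure (A × A)) : Prop :=
  q.map Prod.fst = μ ∧ q.map Prod.snd = ν

/-- The `L^p`-Kantorovich-Wasserstein distance, with values in `[0, ∞]`. -/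
noncomputable def wasserstein {A : Type*} [MeasurableSpace A] [PseudoEMetricSpace A]
    (p : ℝ) (μ ν : Measure A) : ℝ≥0∞ :=
  (⨅ (q : Measure (A × A)) (_ : IsCoupling μ ν q), ∫⁻ z, edist z.1 z.2 ^ p ∂q) ^ (1 / p)

/-! ### Subprobability measures and charged probability measures -/

/-- Subprobability measures on the subspace `Y`. -/
def SubProb {X : Type*} [MeasurableSpace X] (Y : Set X) : Type _ :=
  {μ : Measure Y // μ univ ≤ 1}

/-- The unit mass at a point of `Y`. -/
noncomputable def SubProb.dirac {X : Type*} [MeasurableSpace X] {Y : Set X} (y : Y) : SubProb Y :=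
  ⟨Measure.dirac y, by simp⟩

/-- Charged probability measures: pairs of measures on `X` that agree on `X \ Y` and have
total mass one. -/
structure ChargedProb {X : Type*} [MeasurableSpace X] (Y : Set X) where
  pos : Measure X
  neg : Measure X
  restrict_eq : pos.restrict Yᶜ = neg.restrict Yᶜ
  mass : pos univ + neg univ = 1

/-- The total measure of a charged probability measure. -/
noncomputable def ChargedProb.total {X : Type*} [MeasurableSpace X] {Y : Set X}
    (σ : ChargedProb Y) : Measure X :=
  σ.pos + σ.neg

/-- The effective measure `σ⁺ - σ⁻` is the subprobability measure `μ` on `Y` (regarded as a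
measure on `X`). All measures are finite, so that this is written without subtraction. -/
def ChargedProb.HasEffective {X : Type*} [MeasurableSpace X] {Y : Set X}
    (σ : ChargedProb Y) (μ : SubProb Y) : Prop :=
  σ.pos = σ.neg + μ.1.map Subtype.val

/-- The distance between a particle at `x` and an antiparticle at `y`:
the infimum of `d(x,z) + d(z,y)` over `z ∈ X \ Y`. -/
noncomputable def dStar {X : Type*} [MetricSpace X] (Y : Set X) (x y : X) : ℝ≥0∞ :=
  ⨅ z ∈ Yᶜ, (edist x z + edist z y)

/-- A charged transport plan from `σ` to `τ`: a coupling `pp + pm + mp + mm` of the total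
measures together with a decomposition into its four parts, `pm` being the part
transported from `σ⁺` to `τ⁻`, and so on. -/
structure ChargedPlan {X : Type*} [MeasurableSpace X] {Y : Set X} (σ τ : ChargedProb Y) where
  pp : Measure (X × X)
  pm : Measure (X × X)
  mp : Measure (X × X)
  mm : Measure (X × X)
  fst_pos : pp.map Prod.fst + pm.map Prod.fst = σ.pos
  fst_neg : mp.map Prod.fst + mm.map Prod.fst = σ.neg
  snd_pos : pp.map Prod.snd + mp.map Prod.snd = τ.pos
  snd_neg : pm.map Prod.snd + mm.map Prod.snd = τ.neg

/-- The plan is the canonical decomposition of a coupling `q` of the total measures: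
with densities `u⁺`, `u⁻` of `σ⁺`, `σ⁻` with respect to the total measure of `σ`, and `v⁺`, `v⁻`
likewise for `τ`, its parts are `uⁱ(x) vʲ(y) dq(x,y)`. -/
def ChargedPlan.IsCanonical {X : Type*} [MeasurableSpace X] {Y : Set X} {σ τ : ChargedProb Y}
    (π : ChargedPlan σ τ) : Prop :=
  ∃ (q : Measure (X × X)) (u₁ u₂ v₁ v₂ : X → ℝ≥0∞),
    IsCoupling σ.total τ.total q ∧
    Measurable u₁ ∧ Measurable u₂ ∧ Measurable v₁ ∧ Measurable v₂ ∧
    σ.pos = σ.total.withDensity u₁ ∧ σ.neg = σ.total.withDensity u₂ ∧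
    τ.pos = τ.total.withDensity v₁ ∧ τ.neg = τ.total.withDensity v₂ ∧
    π.pp = q.withDensity (fun z => u₁ z.1 * v₁ z.2) ∧
    π.pm = q.withDensity (fun z => u₁ z.1 * v₂ z.2) ∧
    π.mp = q.withDensity (fun z => u₂ z.1 * v₁ z.2) ∧
    π.mm = q.withDensity (fun z => u₂ z.1 * v₂ z.2)

/-- The `p`-cost of a charged transport plan. -/
noncomputable def ChargedPlan.cost {X : Type*} [MetricSpace X] [MeasurableSpace X] {Y : Set X}
    {σ τ : ChargedProb Y} (p : ℝ) (π : ChargedPlan σ τ) : ℝ≥0∞ :=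
  ∫⁻ z, edist z.1 z.2 ^ p ∂π.pp + ∫⁻ z, dStar Y z.1 z.2 ^ p ∂π.pm +
    ∫⁻ z, dStar Y z.1 z.2 ^ p ∂π.mp + ∫⁻ z, edist z.1 z.2 ^ p ∂π.mm

/-- Two versions of the transportation distance between charged probability measures: minimize
over all charged transport plans, which is the Wasserstein distance on the doubling of `Y`
in `X`, or only over the canonical decompositions of couplings of the total measures. -/
inductive PlanKind
  | all
  | canonical

/-- The plans that are admitted in the two versions. -/
def PlanKind.Admits {X : Type*} [MeasurableSpace X] {Y : Set X} {σ τ : ChargedProb Y} :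
    PlanKind → ChargedPlan σ τ → Prop
  | .all, _ => True
  | .canonical, π => π.IsCanonical

section Distances

variable {X : Type*} [MetricSpace X] [MeasurableSpace X] {Y : Set X}

/-- The `L^p`-transportation distance between charged probability measures. -/
noncomputable def wTilde (κ : PlanKind) (p : ℝ) (σ τ : ChargedProb Y) : ℝ≥0∞ :=
  (⨅ (π : ChargedPlan σ τ) (_ : κ.Admits π), π.cost p) ^ (1 / p)

/-- The transportation-annihilation pre-distance `W⁰_p`. -/
noncomputable def wZero (κ : PlanKind) (p : ℝ) (μ ν : SubProb Y) : ℝ≥0∞ :=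
  ⨅ (σ : ChargedProb Y) (τ : ChargedProb Y) (_ : σ.HasEffective μ) (_ : τ.HasEffective ν),
    wTilde κ p σ τ

/-- The subprobability measures at finite pre-distance from some unit mass on `Y`. -/
def subProbP (κ : PlanKind) (p : ℝ) (Y : Set X) : Set (SubProb Y) :=
  {μ | ∃ y : Y, wZero κ p μ (SubProb.dirac y) < ∞}

/-- `W♭_p`: the infimum of the sums of `W⁰_p` along finite chains of
measures from `subProbP`. -/
noncomputable def wFlat (κ : PlanKind) (p : ℝ) (μ ν : SubProb Y) : ℝ≥0∞ :=
  ⨅ (n : ℕ) (η : Fin (n + 1) → SubProb Y) (_ : ∀ i, η i ∈ subProbP κ p Y)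
    (_ : η 0 = μ) (_ : η (Fin.last n) = ν),
    ∑ i : Fin n, wZero κ p (η i.castSucc) (η i.succ)

/-- The length of a curve with respect to `W♭_p`. -/
noncomputable def lengthFlat (κ : PlanKind) (p : ℝ) (η : unitInterval → SubProb Y) : ℝ≥0∞ :=
  ⨆ (n : ℕ) (s : Fin (n + 1) → unitInterval) (_ : StrictMono s) (_ : s 0 = 0) (_ : s (Fin.last n) = 1),
    ∑ i : Fin n, wFlat κ p (η (s i.castSucc)) (η (s i.succ))

/-- Continuity of a curve with respect to `W♭_p`. -/
def FlatContinuous (κ : PlanKind) (p : ℝ) (η : unitInterval → SubProb Y) : Prop :=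
  ∀ s : unitInterval, Tendsto (fun t => wFlat κ p (η s) (η t)) (𝓝 s) (𝓝 0)

/-- The transportation-annihilation distance `W♯_p`: the infimum of the `W♭_p`-lengths of the
`W♭_p`-continuous curves in `subProbP` from `μ` to `ν`. -/
noncomputable def wSharp (κ : PlanKind) (p : ℝ) (μ ν : SubProb Y) : ℝ≥0∞ :=
  ⨅ (η : unitInterval → SubProb Y) (_ : ∀ s, η s ∈ subProbP κ p Y) (_ : FlatContinuous κ p η)
    (_ : η 0 = μ) (_ : η 1 = ν), lengthFlat κ p η

end Distances

/-! ### The one-point completion with the shortcut metric -/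

/-- The set `Y' = Y ∪ {∂}`. -/
inductive Completion' {X : Type*} (Y : Set X)
  | pt (y : Y)
  | cemetery

namespace Completion'

variable {X : Type*} [MetricSpace X] {Y : Set X}

/-- The distance to the point `∂`. -/
noncomputable def distCemetery : Completion' Y → ℝ
  | pt x => Metric.infDist (x : X) Yᶜ
  | cemetery => 0

/-- The shortcut metric `d'`. -/
noncomputable def sdist : Completion' Y → Completion' Y → ℝ
  | pt x, pt y => min (dist x y) (distCemetery (pt x) + distCemetery (pt y))
  | pt x, cemetery => distCemetery (pt x)
  | cemetery, pt y => distCemetery (pt y)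
  | cemetery, cemetery => 0

theorem infDist_le (x y : Y) :
    Metric.infDist (x : X) Yᶜ ≤ Metric.infDist (y : X) Yᶜ + dist x y :=
  Metric.infDist_le_infDist_add_dist

theorem sdist_triangle (a b c : Completion' Y) : sdist a c ≤ sdist a b + sdist b c := by
  rcases a with x | _ <;> rcases b with y | _ <;> rcases c with z | _ <;>
    simp only [sdist, distCemetery]
  · have hx := Metric.infDist_nonneg (x := (x : X)) (s := Yᶜ)
    have hy := Metric.infDist_nonneg (x := (y : X)) (s := Yᶜ)
    have hz := Metric.infDist_nonneg (x := (z : X)) (s := Yᶜ)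
    have h1 := infDist_le x y
    have h2 := infDist_le z y
    have h3 := dist_triangle x y z
    rw [dist_comm z y] at h2
    rcases min_cases (dist x y) (Metric.infDist (x : X) Yᶜ + Metric.infDist (y : X) Yᶜ) with h | h <;>
    rcases min_cases (dist y z) (Metric.infDist (y : X) Yᶜ + Metric.infDist (z : X) Yᶜ) with h' | h' <;>
    rcases min_cases (dist x z) (Metric.infDist (x : X) Yᶜ + Metric.infDist (z : X) Yᶜ) with k | k <;>
    linarith
  · have hy := Metric.infDist_nonneg (x := (y : X)) (s := Yᶜ)
    have h1 := infDist_le x y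
    rcases min_cases (dist x y) (Metric.infDist (x : X) Yᶜ + Metric.infDist (y : X) Yᶜ) with h | h <;>
    linarith
  · exact min_le_right _ _
  · simp
  · have hy := Metric.infDist_nonneg (x := (y : X)) (s := Yᶜ)
    have h2 := infDist_le z y
    rw [dist_comm z y] at h2
    rcases min_cases (dist y z) (Metric.infDist (y : X) Yᶜ + Metric.infDist (z : X) Yᶜ) with h | h <;>
    linarith
  · have hy := Metric.infDist_nonneg (x := (y : X)) (s := Yᶜ)
    linarith
  · simp
  · simp

/-- The space `(Y', d')`. If `Y` is open and `X \ Y` is nonempty, then `d'` separates points. -/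
noncomputable instance : PseudoMetricSpace (Completion' Y) where
  dist := sdist
  dist_self a := by
    rcases a with x | _
    · have hx := Metric.infDist_nonneg (x := (x : X)) (s := Yᶜ)
      simp [sdist, distCemetery, hx]
    · rfl
  dist_comm a b := by
    rcases a with x | _ <;> rcases b with y | _ <;> simp [sdist, dist_comm, add_comm]
  dist_triangle := sdist_triangle

noncomputable instance : MeasurableSpace (Completion' Y) := borel _

instance : BorelSpace (Completion' Y) := ⟨rfl⟩

end Completion'

/-- The probability measure `μ' = μ + (1 - μ(Y)) δ_∂` on `Y'`. -/
noncomputable def SubProb.extend {X : Type*} [MetricSpace X] [MeasurableSpace X] {Y : Set X}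
    (μ : SubProb Y) : Measure (Completion' Y) :=
  μ.1.map Completion'.pt + (1 - μ.1 univ) • Measure.dirac Completion'.cemetery

/-- The distance `W'_p` between subprobability measures, induced by the
Kantorovich-Wasserstein distance for the shortcut metric on `Y'`. -/
noncomputable def wPrime {X : Type*} [MetricSpace X] [MeasurableSpace X] {Y : Set X}
    (p : ℝ) (μ ν : SubProb Y) : ℝ≥0∞ :=
  wasserstein p μ.extend ν.extend

/-!
The chain `W'₁ ≤ W♭_p ≤ W♯_p ≤ W'_p` on the measures of finite pre-distance to a unit mass gives
everything: for `p = 1` its two ends coincide. The inequality in the middle holds for curves in any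
space.

*Lower bound.* By the triangle inequality for `W'₁` (gluing of couplings) it suffices to compare
`W'₁` with `W⁰_p`, and by Jensen's inequality a charged plan may be priced with exponent one.
Collapse `X \ Y` to `∂`. The particles of a charged plan that stay particles move forwards, the
antiparticles that stay so are transported backwards, and both partners of an annihilation move
to `∂`, which is not dearer than `d*`. This is a coupling of `μ' + η` and `ν' + η` for a common
measure `η`, the collapsed antiparticles and some mass at `∂`
(`exists_transportCost_extend_add_le`). For the cost `d'` common mass can be cancelled
(`transportCost_le_transportCost_add`): using a plan twice in succession shows that halving `η`
does not increase the cost, and a very small `η` does not matter, since the first moments are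
finite.

*Upper bound.* If mass moves in `X` and only its part in `Y` is observed, then `W⁰_p` of the
observed measures is at most the `L^p`-cost in `X`: mass off `Y` is represented by equal
amounts of particles and antiparticles, and for those `d*` reduces to `d`
(`wZero_le_of_maps`). Consider a coupling of `μ'` and `ν'`. In a length space, almost shortest
paths of constant speed and almost closest points off `Y` can be chosen measurably
(`IsLengthSpace.exists_measurable_path`, `exists_measurable_foot`). A particle for which the direct
way is shorter follows its path; any other one runs to a point off `Y`, jumps to another point
off `Y`, which is invisible and free, and runs on. When the jump times are rounded to multiples of
`1 / N` the speed remains at most `K ^ 3` times the `d'`-distance, with `K` close to `1`, and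
between two multiples nobody jumps. So the observed measures form a Lipschitz curve for `W♭_p`
(`wSharp_le_of_paths`).
-/

/-! ### Optimal transport of measures of arbitrary mass for the cost `edist` -/

section Transport

variable {A : Type*} [MeasurableSpace A]

/-- The total cost of an optimal transport between two measures of arbitrary mass, for the cost
function `edist`. It is `∞` if the masses differ. -/
noncomputable def transportCost [PseudoEMetricSpace A] (μ ν : Measure A) : ℝ≥0∞ :=
  ⨅ (q : Measure (A × A)) (_ : IsCoupling μ ν q), ∫⁻ z, edist z.1 z.2 ∂q

theorem wasserstein_one [PseudoEMetricSpace A] (μ ν : Measure A) :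
    wasserstein 1 μ ν = transportCost μ ν := by
  simp [wasserstein, transportCost]

theorem transportCost_le [PseudoEMetricSpace A] {μ ν : Measure A} {q : Measure (A × A)}
    (h : IsCoupling μ ν q) : transportCost μ ν ≤ ∫⁻ z, edist z.1 z.2 ∂q :=
  iInf₂_le q h

theorem withDensity_comp_map {B : Type*} [MeasurableSpace B] (q : Measure A) {f : A → B}
    (hf : Measurable f) {u : B → ℝ≥0∞} (hu : Measurable u) :
    (q.withDensity (fun a => u (f a))).map f = (q.map f).withDensity u := by
  ext s hs
  rw [Measure.map_apply hf hs, withDensity_apply _ (hf hs), withDensity_apply _ hs,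
    setLIntegral_map hs hu hf]

theorem exists_density_le_one {μ m : Measure A} [IsFiniteMeasure m] (h : μ ≤ m) :
    ∃ u : A → ℝ≥0∞, Measurable u ∧ (∀ a, u a ≤ 1) ∧ m.withDensity u = μ := by
  have : IsFiniteMeasure μ := isFiniteMeasure_of_le m h
  refine ⟨fun a => min (μ.rnDeriv m a) 1, (Measure.measurable_rnDeriv μ m).min measurable_const,
    fun a => min_le_right _ _, ?_⟩
  have h1 : (fun a => min (μ.rnDeriv m a) 1) =ᵐ[m] μ.rnDeriv m := by
    filter_upwards [Measure.rnDeriv_le_one_of_le h] with a ha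
    exact min_eq_left ha
  rw [withDensity_congr_ae h1,
    Measure.withDensity_rnDeriv_eq μ m (Measure.absolutelyContinuous_of_le h)]

/-- Uniform integrability: an integrable function has small integrals with respect to the measures
below `μ` of small mass. -/
theorem exists_forall_lintegral_le_of_measure_le {μ : Measure A} {f : A → ℝ≥0∞} (hm : Measurable f)
    (hf : ∫⁻ a, f a ∂μ ≠ ∞) {ε : ℝ≥0∞} (hε : ε ≠ 0) :
    ∃ δ : ℝ≥0∞, δ ≠ 0 ∧ ∀ r ≤ μ, r univ ≤ δ → ∫⁻ a, f a ∂r ≤ ε := by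
  have hlim : Tendsto (fun n : ℕ => ∫⁻ a, (f a - min (f a) n) ∂μ) atTop (𝓝 (∫⁻ _, 0 ∂μ)) := by
    refine tendsto_lintegral_of_dominated_convergence f (fun n => by fun_prop)
      (fun n => ae_of_all _ fun a => tsub_le_self) hf ?_
    filter_upwards [ae_lt_top hm hf] with a ha
    refine tendsto_const_nhds.congr' ?_
    obtain ⟨n, hn⟩ := ENNReal.exists_nat_gt ha.ne
    filter_upwards [eventually_ge_atTop n] with k hk
    rw [min_eq_left (hn.le.trans (by exact_mod_cast hk)), tsub_self]
  rw [lintegral_zero] at hlim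
  obtain ⟨n, hn⟩ := (hlim.eventually_lt_const (ENNReal.half_pos hε)).exists
  refine ⟨ε / 2 / (n + 1), by simp [ENNReal.div_eq_zero_iff, hε], fun r hr hδ => ?_⟩
  calc ∫⁻ a, f a ∂r ≤ ∫⁻ a, ((f a - min (f a) n) + (n + 1)) ∂r := by
        refine lintegral_mono fun a => ?_
        calc f a ≤ (f a - min (f a) n) + min (f a) n := le_tsub_add
          _ ≤ _ := by gcongr; exact (min_le_right _ _).trans le_self_add
    _ = ∫⁻ a, (f a - min (f a) n) ∂r + (n + 1) * r univ := by
        rw [lintegral_add_right _ measurable_const, lintegral_const]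
    _ ≤ ε / 2 + (n + 1) * (ε / 2 / (n + 1)) := by
        gcongr
        exact (lintegral_mono' hr le_rfl).trans hn.le
    _ = ε := by
        rw [ENNReal.mul_div_cancel (by simp) (by finiteness), ENNReal.add_halves]

/-- Gluing of couplings along the common marginal. -/
theorem exists_gluing [StandardBorelSpace A] [Nonempty A] {μ ν ξ : Measure A}
    {q r : Measure (A × A)} [IsFiniteMeasure q] [IsFiniteMeasure r] (hq : IsCoupling μ ν q)
    (hr : IsCoupling ν ξ r) :
    ∃ ρ : Measure ((A × A) × A), ρ.map Prod.fst = q ∧ ρ.map (fun z => (z.1.2, z.2)) = r := by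
  have hm : Measurable fun z : (A × A) × A => (z.1.2, z.2) := by fun_prop
  refine ⟨q.compProd (r.condKernel.comap Prod.snd measurable_snd), ?_, ?_⟩
  · exact Measure.fst_compProd _ _
  · refine Measure.ext_of_lintegral _ fun f hf => ?_
    have hf' : Measurable fun z : (A × A) × A => f (z.1.2, z.2) := hf.comp hm
    rw [lintegral_map hf hm, Measure.lintegral_compProd hf']
    have h1 : r.fst = q.map Prod.snd := by rw [hq.2, Measure.fst, hr.1]
    conv_rhs => rw [← r.disintegrate r.condKernel, Measure.lintegral_compProd hf, h1]
    rw [lintegral_map (Measurable.lintegral_kernel_prod_right' hf) measurable_snd]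
    rfl

theorem isFiniteMeasure_of_isCoupling {μ ν : Measure A} [IsFiniteMeasure μ]
    {q : Measure (A × A)} (h : IsCoupling μ ν q) : IsFiniteMeasure q := by
  constructor
  have : q univ = μ univ := by
    rw [← h.1, Measure.map_apply measurable_fst .univ, preimage_univ]
  rw [this]; exact measure_lt_top _ _

theorem transportCost_add_le [PseudoEMetricSpace A] (μ ν μ' ν' : Measure A) :
    transportCost (μ + μ') (ν + ν') ≤ transportCost μ ν + transportCost μ' ν' := by
  conv_rhs => unfold transportCost
  simp_rw [ENNReal.iInf_add, ENNReal.add_iInf]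
  refine le_iInf₂ fun q hq => le_iInf₂ fun r hr => ?_
  refine (transportCost_le (q := q + r) ⟨?_, ?_⟩).trans_eq (lintegral_add_measure _ _ _)
  · rw [Measure.map_add _ _ measurable_fst, hq.1, hr.1]
  · rw [Measure.map_add _ _ measurable_snd, hq.2, hr.2]

theorem transportCost_smul_le [PseudoEMetricSpace A] (c : ℝ≥0∞) (μ ν : Measure A)
    (hc : c ≠ ∞) (hc0 : c ≠ 0) :
    transportCost (c • μ) (c • ν) ≤ c * transportCost μ ν := by
  conv_rhs => unfold transportCost
  simp_rw [ENNReal.mul_iInf_of_ne hc0 hc]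
  refine le_iInf₂ fun q hq => ?_
  refine (transportCost_le (q := c • q) ⟨?_, ?_⟩).trans_eq (lintegral_smul_measure _ _)
  · rw [Measure.map_smul, hq.1]
  · rw [Measure.map_smul, hq.2]

section EMetric

variable [PseudoEMetricSpace A] [BorelSpace A] [SecondCountableTopology A]

theorem transportCost_self (μ : Measure A) : transportCost μ μ = 0 := by
  have h : IsCoupling μ μ (μ.map fun a => (a, a)) := by
    constructor <;> rw [Measure.map_map (by fun_prop) (by fun_prop)] <;> exact Measure.map_id
  refine le_antisymm ((transportCost_le h).trans ?_) zero_le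
  rw [lintegral_map measurable_edist (by fun_prop)]
  simp

theorem transportCost_triangle [StandardBorelSpace A] [Nonempty A] (μ ν ξ : Measure A)
    [IsFiniteMeasure μ] [IsFiniteMeasure ν] :
    transportCost μ ξ ≤ transportCost μ ν + transportCost ν ξ := by
  unfold transportCost
  simp_rw [ENNReal.iInf_add, ENNReal.add_iInf]
  refine le_iInf₂ fun q hq => le_iInf₂ fun r hr => ?_
  have := isFiniteMeasure_of_isCoupling hq
  have := isFiniteMeasure_of_isCoupling hr
  obtain ⟨ρ, h1, h2⟩ := exists_gluing hq hr
  have hm : Measurable fun z : (A × A) × A => (z.1.2, z.2) := by fun_prop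
  have hm' : Measurable fun z : (A × A) × A => (z.1.1, z.2) := by fun_prop
  have hc : IsCoupling μ ξ (ρ.map fun z => (z.1.1, z.2)) := by
    constructor
    · rw [Measure.map_map measurable_fst hm', ← hq.1, ← h1,
        Measure.map_map measurable_fst measurable_fst]
      rfl
    · rw [Measure.map_map measurable_snd hm', ← hr.2, ← h2, Measure.map_map measurable_snd hm]
      rfl
  refine (iInf₂_le _ hc).trans ?_
  rw [← h1, ← h2, lintegral_map measurable_edist hm', lintegral_map measurable_edist hm,
    lintegral_map measurable_edist measurable_fst, ← lintegral_add_left (by fun_prop)]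
  exact lintegral_mono fun z => edist_triangle _ _ _

/-- Doubling the mass that is actually transported halves the common part: the plan is used
twice in succession, first for one copy of `μ`, then for the other. -/
theorem transportCost_add_half_le [StandardBorelSpace A] [Nonempty A] (μ ν η : Measure A)
    [IsFiniteMeasure μ] [IsFiniteMeasure ν] [IsFiniteMeasure η] :
    transportCost (μ + (2⁻¹ : ℝ≥0∞) • η) (ν + (2⁻¹ : ℝ≥0∞) • η) ≤
      transportCost (μ + η) (ν + η) := by
  have key : ∀ m : Measure A, m + (2⁻¹ : ℝ≥0∞) • η = (2⁻¹ : ℝ≥0∞) • (m + (m + η)) := by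
    intro m
    rw [← add_assoc, smul_add, ← two_smul ℝ≥0∞ m, smul_smul,
      ENNReal.inv_mul_cancel (by simp) (by simp), one_smul]
  rw [key μ, key ν]
  refine (transportCost_smul_le _ _ _ (by simp) (by simp)).trans ?_
  have h1 : transportCost (μ + (μ + η)) (ν + (ν + η)) ≤ 2 * transportCost (μ + η) (ν + η) := by
    refine (transportCost_triangle _ (μ + (ν + η)) _).trans ?_
    rw [two_mul]
    refine add_le_add ?_ ?_
    · simpa [transportCost_self] using transportCost_add_le μ μ (μ + η) (ν + η)
    · rw [show μ + (ν + η) = ν + (μ + η) by abel]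
      simpa [transportCost_self] using transportCost_add_le ν ν (μ + η) (ν + η)
  calc (2⁻¹ : ℝ≥0∞) * transportCost (μ + (μ + η)) (ν + (ν + η))
      ≤ 2⁻¹ * (2 * transportCost (μ + η) (ν + η)) := by gcongr
    _ = _ := by rw [← mul_assoc, ENNReal.inv_mul_cancel (by simp) (by simp), one_mul]

theorem transportCost_add_pow_half_le [StandardBorelSpace A] [Nonempty A] (μ ν η : Measure A)
    [IsFiniteMeasure μ] [IsFiniteMeasure ν] [IsFiniteMeasure η] (n : ℕ) :
    transportCost (μ + (2⁻¹ ^ n : ℝ≥0∞) • η) (ν + (2⁻¹ ^ n : ℝ≥0∞) • η) ≤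
      transportCost (μ + η) (ν + η) := by
  induction n with
  | zero => simp
  | succ n ih =>
    have : IsFiniteMeasure ((2⁻¹ ^ n : ℝ≥0∞) • η) := η.smul_finite (by finiteness)
    refine le_trans ?_ ih
    rw [pow_succ', ← smul_smul]
    exact transportCost_add_half_le _ _ _

/-- A competitor for the transport cost: move all mass to `e` and from there to its target. -/
theorem transportCost_le_moments [StandardBorelSpace A] (e : A) (r s : Measure A)
    [IsFiniteMeasure r] (h : r univ = s univ) :
    transportCost r s ≤ ∫⁻ a, edist a e ∂r + ∫⁻ a, edist a e ∂s := by
  have : Nonempty A := ⟨e⟩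
  have : IsFiniteMeasure (r univ • Measure.dirac e) := (Measure.dirac e).smul_finite (by finiteness)
  refine (transportCost_triangle r (r univ • Measure.dirac e) s).trans (add_le_add ?_ ?_)
  · refine (transportCost_le (q := r.map fun a => (a, e)) ⟨?_, ?_⟩).trans_eq ?_
    · rw [Measure.map_map (by fun_prop) (by fun_prop)]; exact Measure.map_id
    · rw [Measure.map_map (by fun_prop) (by fun_prop)]; exact Measure.map_const _ _
    · rw [lintegral_map measurable_edist (by fun_prop)]
  · refine (transportCost_le (q := s.map fun a => (e, a)) ⟨?_, ?_⟩).trans_eq ?_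
    · rw [Measure.map_map (by fun_prop) (by fun_prop), h]; exact Measure.map_const _ _
    · rw [Measure.map_map (by fun_prop) (by fun_prop)]; exact Measure.map_id
    · rw [lintegral_map measurable_edist (by fun_prop)]
      simp_rw [edist_comm e]

/-- A small common part can be removed at a small price: the residual masses that the plan
exchanges with the common part are small and have small first moments. -/
theorem exists_transportCost_le_add [StandardBorelSpace A] (e : A) {μ ν : Measure A}
    [IsFiniteMeasure μ] [IsFiniteMeasure ν] (hmass : μ univ = ν univ)
    (hμ : ∫⁻ a, edist a e ∂μ ≠ ∞) (hν : ∫⁻ a, edist a e ∂ν ≠ ∞) {ε : ℝ≥0∞} (hε : ε ≠ 0) :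
    ∃ δ : ℝ≥0∞, δ ≠ 0 ∧ ∀ η : Measure A, IsFiniteMeasure η → η univ ≤ δ →
      transportCost μ ν ≤ transportCost (μ + η) (ν + η) + ε := by
  have he : Measurable fun a : A => edist a e := by fun_prop
  have hε2 := (ENNReal.half_pos hε).ne'
  obtain ⟨δ₁, hδ₁, h₁⟩ := exists_forall_lintegral_le_of_measure_le he hμ hε2
  obtain ⟨δ₂, hδ₂, h₂⟩ := exists_forall_lintegral_le_of_measure_le he hν hε2
  refine ⟨min δ₁ δ₂, (lt_min (pos_iff_ne_zero.2 hδ₁) (pos_iff_ne_zero.2 hδ₂)).ne',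
    fun η hη hηδ => ?_⟩
  conv_rhs => unfold transportCost
  simp_rw [ENNReal.iInf_add]
  refine le_iInf₂ fun q hq => ?_
  have := isFiniteMeasure_of_isCoupling hq
  obtain ⟨u, hu, hu1, hμu⟩ := exists_density_le_one (μ := μ) (m := μ + η)
    (Measure.le_add_right le_rfl)
  obtain ⟨v, hv, hv1, hνv⟩ := exists_density_le_one (μ := ν) (m := ν + η)
    (Measure.le_add_right le_rfl)
  -- `q₀` is the part of the plan that leads from `μ` to `ν`, `q₁` the part from `μ` to `η`,
  -- and `q₂` the part from `η` to `ν`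
  set q₀ := q.withDensity fun z => u z.1 * v z.2
  set q₁ := q.withDensity fun z => u z.1 * (1 - v z.2)
  set q₂ := q.withDensity fun z => (1 - u z.1) * v z.2
  have hq₀ : q₀ ≤ q := by
    refine (withDensity_mono (ae_of_all _ fun z => ?_)).trans_eq (withDensity_one (μ := q))
    exact mul_le_one' (hu1 _) (hv1 _)
  have hfst : q₀.map Prod.fst + q₁.map Prod.fst = μ := by
    rw [← Measure.map_add _ _ measurable_fst, ← withDensity_add_left (by fun_prop), ← hμu, ← hq.1,
      ← withDensity_comp_map q measurable_fst hu]
    congr 2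
    ext z
    simp only [Pi.add_apply]
    rw [← mul_add, add_tsub_cancel_of_le (hv1 _), mul_one]
  have hsnd : q₀.map Prod.snd + q₂.map Prod.snd = ν := by
    rw [← Measure.map_add _ _ measurable_snd, ← withDensity_add_left (by fun_prop), ← hνv, ← hq.2,
      ← withDensity_comp_map q measurable_snd hv]
    congr 2
    ext z
    simp only [Pi.add_apply]
    rw [← add_mul, add_tsub_cancel_of_le (hu1 _), one_mul]
  have hle₁ : q₁.map Prod.fst ≤ μ := hfst ▸ Measure.le_add_left le_rfl
  have hle₂ : q₂.map Prod.snd ≤ ν := hsnd ▸ Measure.le_add_left le_rfl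
  have hf₀ : IsFiniteMeasure q₀ := isFiniteMeasure_of_le q hq₀
  have hf₁ : IsFiniteMeasure (q₁.map Prod.fst) := isFiniteMeasure_of_le μ hle₁
  have huniv : ∀ m : Measure (A × A), ∀ f : A × A → A, Measurable f → (m.map f) univ = m univ :=
    fun m f hf => by rw [Measure.map_apply hf .univ, preimage_univ]
  have hmass' : (q₁.map Prod.fst) univ = (q₂.map Prod.snd) univ := by
    have h : q₀ univ + (q₁.map Prod.fst) univ = q₀ univ + (q₂.map Prod.snd) univ := by
      rw [← huniv q₀ _ measurable_fst, ← Measure.add_apply, hfst, huniv q₀ _ measurable_fst,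
        ← huniv q₀ _ measurable_snd, ← Measure.add_apply, hsnd, hmass]
    exact (ENNReal.add_right_inj (measure_ne_top _ _)).1 h
  have hsmall : (q₁.map Prod.fst) univ ≤ η univ := by
    have h1 : (q₁.map Prod.fst) univ ≤ ((ν + η).withDensity fun a => 1 - v a) univ := by
      rw [← hq.2, ← withDensity_comp_map q measurable_snd (by fun_prop), huniv _ _ measurable_fst,
        huniv _ _ measurable_snd]
      exact withDensity_mono (ae_of_all _ fun z => mul_le_of_le_one_left' (hu1 _)) univ
    have h2 : ν + (ν + η).withDensity (fun a => 1 - v a) = ν + η := by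
      calc ν + (ν + η).withDensity (fun a => 1 - v a)
          = (ν + η).withDensity v + (ν + η).withDensity (fun a => 1 - v a) := by rw [hνv]
        _ = (ν + η).withDensity 1 := by
            rw [← withDensity_add_left hv]
            congr 1
            ext a
            exact add_tsub_cancel_of_le (hv1 a)
        _ = ν + η := withDensity_one
    have h3 := congrArg (fun m : Measure A => m univ) h2
    simp only [Measure.add_apply] at h3
    exact h1.trans ((ENNReal.add_right_inj (measure_ne_top ν _)).1 h3).le
  calc transportCost μ ν
      ≤ transportCost (q₀.map Prod.fst) (q₀.map Prod.snd) +
        transportCost (q₁.map Prod.fst) (q₂.map Prod.snd) := by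
          conv_lhs => rw [← hfst, ← hsnd]
          exact transportCost_add_le _ _ _ _
    _ ≤ ∫⁻ z, edist z.1 z.2 ∂q + (ε / 2 + ε / 2) := by
          refine add_le_add ((transportCost_le ⟨rfl, rfl⟩).trans (lintegral_mono' hq₀ le_rfl)) ?_
          refine (transportCost_le_moments e _ _ hmass').trans (add_le_add ?_ ?_)
          · exact h₁ _ hle₁ (hsmall.trans (hηδ.trans (min_le_left _ _)))
          · exact h₂ _ hle₂ (hmass' ▸ hsmall.trans (hηδ.trans (min_le_right _ _)))
    _ = _ := by rw [ENNReal.add_halves]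

/-- Common mass can be cancelled in optimal transport for the cost `edist`: after repeated halving,
the common part is negligible. -/
theorem transportCost_le_transportCost_add [StandardBorelSpace A] (e : A) {μ ν : Measure A}
    [IsFiniteMeasure μ] [IsFiniteMeasure ν] (hmass : μ univ = ν univ)
    (hμ : ∫⁻ a, edist a e ∂μ ≠ ∞) (hν : ∫⁻ a, edist a e ∂ν ≠ ∞) (η : Measure A)
    [IsFiniteMeasure η] : transportCost μ ν ≤ transportCost (μ + η) (ν + η) := by
  have : Nonempty A := ⟨e⟩
  refine _root_.le_of_forall_pos_le_add fun ε hε => ?_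
  obtain ⟨δ, hδ, h⟩ := exists_transportCost_le_add e hmass hμ hν hε.ne'
  have hlim : Tendsto (fun n : ℕ => (2⁻¹ ^ n : ℝ≥0∞) * η univ) atTop (𝓝 (0 * η univ)) :=
    ENNReal.Tendsto.mul_const
      (ENNReal.tendsto_pow_atTop_nhds_zero_of_lt_one (by simp)) (Or.inr (measure_ne_top _ _))
  rw [zero_mul] at hlim
  obtain ⟨n, hn⟩ := (hlim.eventually_lt_const (pos_iff_ne_zero.2 hδ)).exists
  refine (h ((2⁻¹ ^ n : ℝ≥0∞) • η) (η.smul_finite (by finiteness)) hn.le).trans ?_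
  gcongr
  exact transportCost_add_pow_half_le μ ν η n

end EMetric

end Transport

/-! ### The one-point completion as a standard Borel space -/

theorem MeasurableEquiv.standardBorelSpace {α β : Type*} [MeasurableSpace α] [MeasurableSpace β]
    [StandardBorelSpace β] (e : α ≃ᵐ β) : StandardBorelSpace α := by
  obtain ⟨t, _, _⟩ := StandardBorelSpace.polish (α := β)
  let _ : TopologicalSpace α := TopologicalSpace.induced e t
  refine ⟨⟨inferInstance, ⟨?_⟩, ?_⟩⟩
  · rw [borel_comap, ← BorelSpace.measurable_eq, e.measurableEmbedding.comap_eq]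
  · exact (Topology.IsClosedEmbedding.polishSpace
      (f := e) ⟨⟨⟨rfl⟩, e.injective⟩, by simp [e.surjective.range_eq]⟩)

namespace Completion'

section Maps

variable {X : Type*} {Y : Set X}

variable (Y) in
/-- The points of `Y` on their place in `X`, and `∂` on a given point. -/
def toAmbient (z₀ : X) : Completion' Y → X
  | pt x => x
  | cemetery => z₀

variable (Y) in
open Classical in
/-- The map that collapses `X \ Y` to `∂`. -/
noncomputable def collapse (x : X) : Completion' Y :=
  if h : x ∈ Y then pt ⟨x, h⟩ else cemetery

theorem collapse_coe (x : Y) : collapse Y (x : X) = pt x := by simp [collapse]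

theorem collapse_of_notMem {x : X} (h : x ∉ Y) : collapse Y x = cemetery := by simp [collapse, h]

theorem collapse_toAmbient {z₀ : X} (hz₀ : z₀ ∉ Y) (a : Completion' Y) :
    collapse Y (toAmbient Y z₀ a) = a := by
  cases a
  · exact collapse_coe _
  · exact collapse_of_notMem hz₀

end Maps

variable {X : Type*} [MetricSpace X] {Y : Set X}

theorem dist_def (a b : Completion' Y) : dist a b = sdist a b := rfl

theorem distCemetery_nonneg (a : Completion' Y) : 0 ≤ distCemetery a := by
  cases a
  · exact Metric.infDist_nonneg
  · exact le_rfl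

theorem dist_cemetery (a : Completion' Y) : dist a cemetery = distCemetery a := by
  cases a <;> rfl

theorem continuous_distCemetery : Continuous (distCemetery : Completion' Y → ℝ) := by
  simp_rw [← funext dist_cemetery]
  fun_prop

theorem dist_pt_le (x y : Y) : dist (pt x) (pt y) ≤ dist x y := min_le_left _ _

theorem continuous_pt : Continuous (pt : Y → Completion' Y) :=
  (LipschitzWith.mk_one dist_pt_le).continuous

theorem distCemetery_pt_pos (hY : IsOpen Y) (hne : Y ≠ univ) (x : Y) :
    0 < distCemetery (pt x) :=
  (hY.isClosed_compl.notMem_iff_infDist_pos (nonempty_compl.2 hne)).1 (fun h => h x.2)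

theorem t0Space (hY : IsOpen Y) (hne : Y ≠ univ) : T0Space (Completion' Y) := by
  refine ⟨fun a b h => ?_⟩
  have h0 : sdist a b = 0 := Metric.inseparable_iff.1 h
  rcases a with x | _ <;> rcases b with y | _
  · have hx := distCemetery_pt_pos hY hne x
    have hy := distCemetery_pt_pos hY hne y
    simp only [sdist] at h0
    rcases min_cases (dist x y) (distCemetery (pt x) + distCemetery (pt y)) with h | h
    · rw [dist_eq_zero.1 (h.1.symm.trans h0)]
    · linarith
  · exact absurd h0 (distCemetery_pt_pos hY hne x).ne'
  · exact absurd h0 (distCemetery_pt_pos hY hne y).ne'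
  · rfl

theorem distCemetery_collapse (x : X) : distCemetery (collapse Y x) = Metric.infDist x Yᶜ := by
  by_cases h : x ∈ Y
  · simp [collapse, h, distCemetery]
  · rw [collapse_of_notMem h, Metric.infDist_zero_of_mem (show x ∈ Yᶜ from h)]; rfl

theorem dist_collapse_le (x y : X) : dist (collapse Y x) (collapse Y y) ≤ dist x y := by
  by_cases hx : x ∈ Y <;> by_cases hy : y ∈ Y
  · exact (congrArg₂ dist (collapse_coe ⟨x, hx⟩) (collapse_coe ⟨y, hy⟩)).trans_le (dist_pt_le _ _)
  · rw [collapse_of_notMem hy, dist_cemetery, distCemetery_collapse]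
    exact Metric.infDist_le_dist_of_mem hy
  · rw [collapse_of_notMem hx, dist_comm, dist_cemetery, distCemetery_collapse, dist_comm]
    exact Metric.infDist_le_dist_of_mem hx
  · rw [collapse_of_notMem hx, collapse_of_notMem hy, dist_self]
    exact dist_nonneg

theorem edist_collapse_le (x y : X) : edist (collapse Y x) (collapse Y y) ≤ edist x y := by
  rw [edist_dist, edist_dist]
  exact ENNReal.ofReal_le_ofReal (dist_collapse_le x y)

theorem continuous_collapse : Continuous (collapse Y : X → Completion' Y) :=
  (LipschitzWith.of_edist_le edist_collapse_le).continuous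

/-- The shortcut metric in terms of the ambient space: either move directly, or via `∂`. -/
theorem dist_eq_min (z₀ : X) (hz₀ : z₀ ∉ Y) (a b : Completion' Y) :
    dist a b = min (dist (toAmbient Y z₀ a) (toAmbient Y z₀ b))
      (distCemetery a + distCemetery b) := by
  rcases a with x | _ <;> rcases b with y | _
  · rfl
  · simp only [dist_def, sdist, toAmbient, distCemetery, add_zero]
    exact (min_eq_right (Metric.infDist_le_dist_of_mem hz₀)).symm
  · simp only [dist_def, sdist, toAmbient, distCemetery, zero_add]
    rw [dist_comm]
    exact (min_eq_right (Metric.infDist_le_dist_of_mem hz₀)).symm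
  · simp [toAmbient, distCemetery]

theorem secondCountableTopology [TopologicalSpace.SeparableSpace X] (hne : Y ≠ univ) :
    SecondCountableTopology (Completion' Y) := by
  obtain ⟨z₀, hz₀⟩ := nonempty_compl.2 hne
  have h : TopologicalSpace.SeparableSpace (Completion' Y) :=
    (Function.RightInverse.surjective (collapse_toAmbient hz₀)).denseRange.separableSpace
      continuous_collapse
  exact UniformSpace.secondCountable_of_separable _

variable [CompleteSpace X] [TopologicalSpace.SeparableSpace X] [MeasurableSpace X] [BorelSpace X]

theorem measurable_toAmbient (hY : IsOpen Y) {z₀ : X} (hz₀ : z₀ ∉ Y) :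
    Measurable (toAmbient Y z₀) := by
  have hne : Y ≠ univ := fun h => hz₀ (h ▸ mem_univ _)
  have := t0Space hY hne
  have := secondCountableTopology hne
  intro S hS
  have h : toAmbient Y z₀ ⁻¹' S = collapse Y '' (S ∩ (Y ∪ {z₀})) := by
    ext a
    constructor
    · intro ha
      refine ⟨toAmbient Y z₀ a, ⟨ha, ?_⟩, collapse_toAmbient hz₀ a⟩
      cases a <;> simp [toAmbient]
    · rintro ⟨x, ⟨hx, hxY | rfl⟩, rfl⟩
      · rw [mem_preimage, show collapse Y x = pt ⟨x, hxY⟩ from collapse_coe ⟨x, hxY⟩]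
        exact hx
      · rw [mem_preimage, collapse_of_notMem hz₀]
        exact hx
  rw [h]
  refine MeasurableSet.image_of_continuousOn_injOn
    (hS.inter (hY.measurableSet.union (measurableSet_singleton z₀)))
    continuous_collapse.continuousOn ?_
  rintro x ⟨-, hx⟩ y ⟨-, hy⟩ hxy
  have key : ∀ x, x ∈ Y ∪ {z₀} → toAmbient Y z₀ (collapse Y x) = x := by
    rintro x (hx | rfl)
    · rw [show collapse Y x = pt ⟨x, hx⟩ from collapse_coe ⟨x, hx⟩]; rfl
    · rw [collapse_of_notMem hz₀]; rfl
  rw [← key x hx, ← key y hy, hxy]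

theorem standardBorelSpace (hY : IsOpen Y) (hne : Y ≠ univ) :
    StandardBorelSpace (Completion' Y) := by
  obtain ⟨z₀, hz₀⟩ := nonempty_compl.2 hne
  have h : MeasurableEmbedding (toAmbient Y z₀) := by
    refine MeasurableEmbedding.of_measurable_inverse (measurable_toAmbient hY hz₀) ?_
      continuous_collapse.measurable (collapse_toAmbient hz₀)
    have : range (toAmbient Y z₀) = Y ∪ {z₀} := by
      ext x
      constructor
      · rintro ⟨a, rfl⟩
        cases a <;> simp [toAmbient]
      · rintro (hx | rfl)
        · exact ⟨pt ⟨x, hx⟩, rfl⟩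
        · exact ⟨cemetery, rfl⟩
    rw [this]
    exact hY.measurableSet.union (measurableSet_singleton z₀)
  have := h.measurableSet_range.standardBorel
  exact h.equivRange.standardBorelSpace

end Completion'

/-! ### Charged transport plans bound the distance on the completion -/

theorem transportCost_map_map_le {Ω A : Type*} [MeasurableSpace Ω] [MeasurableSpace A]
    [PseudoEMetricSpace A] [BorelSpace A] [SecondCountableTopology A] (m : Measure Ω) {f g : Ω → A}
    (hf : Measurable f) (hg : Measurable g) :
    transportCost (m.map f) (m.map g) ≤ ∫⁻ a, edist (f a) (g a) ∂m := by
  refine (transportCost_le (q := m.map fun a => (f a, g a)) ⟨?_, ?_⟩).trans_eq ?_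
  · rw [Measure.map_map (by fun_prop) (by fun_prop)]; rfl
  · rw [Measure.map_map (by fun_prop) (by fun_prop)]; rfl
  · rw [lintegral_map measurable_edist (by fun_prop)]

theorem lintegral_rpow_one_le {A : Type*} [MeasurableSpace A] {p : ℝ} (hp : 1 ≤ p) (m : Measure A)
    {f : A → ℝ≥0∞} (hf : Measurable f) :
    ∫⁻ a, f a ∂m ≤ (∫⁻ a, f a ^ p ∂m) ^ (1 / p) * m univ ^ (1 - 1 / p) := by
  rcases hp.eq_or_lt with rfl | hp
  · simp
  have hpq := Real.HolderConjugate.conjExponent hp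
  have h := ENNReal.lintegral_mul_le_Lp_mul_Lq m hpq hf.aemeasurable
    (g := 1) aemeasurable_const
  have he : 1 / p.conjExponent = 1 - 1 / p := by
    rw [one_div, one_div, hpq.symm.one_sub_inv.symm]
    simp
  simpa [he] using h

section Masses

variable {X : Type*} [MeasurableSpace X] {Y : Set X}

theorem ChargedPlan.univ_eq {σ τ : ChargedProb Y} (π : ChargedPlan σ τ) :
    π.pp univ + π.pm univ + π.mp univ + π.mm univ = 1 := by
  have h := σ.mass
  rw [← π.fst_pos, ← π.fst_neg] at h
  simp only [Measure.add_apply, Measure.map_apply measurable_fst .univ, preimage_univ] at h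
  rw [← h]; ring

theorem ChargedProb.isFiniteMeasure_pos (σ : ChargedProb Y) : IsFiniteMeasure σ.pos :=
  ⟨lt_of_le_of_lt (le_self_add.trans_eq σ.mass) ENNReal.one_lt_top⟩

theorem ChargedProb.isFiniteMeasure_neg (σ : ChargedProb Y) : IsFiniteMeasure σ.neg :=
  ⟨lt_of_le_of_lt (le_add_self.trans_eq σ.mass) ENNReal.one_lt_top⟩

theorem SubProb.map_coe_univ (μ : SubProb Y) : (μ.1.map Subtype.val) univ = μ.1 univ := by
  rw [Measure.map_apply measurable_subtype_coe .univ, preimage_univ]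

end Masses

theorem edist_cemetery_add_le_dStar {X : Type*} [MetricSpace X] {Y : Set X} (x y : X) :
    edist (Completion'.collapse Y x) Completion'.cemetery +
      edist (Completion'.collapse Y y) Completion'.cemetery ≤ dStar Y x y := by
  refine le_iInf₂ fun z hz => ?_
  rw [← Completion'.collapse_of_notMem (show z ∉ Y from hz), edist_comm z y]
  exact add_le_add (Completion'.edist_collapse_le _ _) (Completion'.edist_collapse_le _ _)

section Charged

variable {X : Type*} [MetricSpace X] [MeasurableSpace X] [BorelSpace X] {Y : Set X}

theorem measurable_dStar [SecondCountableTopology X] :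
    Measurable fun z : X × X => dStar Y z.1 z.2 := by
  refine UpperSemicontinuous.measurable ?_
  unfold dStar
  refine upperSemicontinuous_biInf fun z hz => ?_
  exact Continuous.upperSemicontinuous (by fun_prop)

/-- Jensen's inequality for the cost of charged transport plans, which have total mass one. -/
theorem ChargedPlan.cost_one_le [SecondCountableTopology X] {p : ℝ} (hp : 1 ≤ p)
    {σ τ : ChargedProb Y} (π : ChargedPlan σ τ) : π.cost 1 ≤ π.cost p ^ (1 / p) := by
  let m : Fin 4 → Measure (X × X) := ![π.pp, π.pm, π.mp, π.mm]
  let f : Fin 4 → X × X → ℝ≥0∞ := ![fun z => edist z.1 z.2, fun z => dStar Y z.1 z.2,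
    fun z => dStar Y z.1 z.2, fun z => edist z.1 z.2]
  have hcost : ∀ r : ℝ, π.cost r = ∑ i, ∫⁻ z, f i z ^ r ∂m i := fun r => by
    simp [ChargedPlan.cost, Fin.sum_univ_four, m, f]
  have hm : ∑ i, m i univ = 1 := by
    simpa [Fin.sum_univ_four, m] using π.univ_eq
  have hf : ∀ i, Measurable (f i) := by
    intro i
    fin_cases i
    exacts [measurable_edist, measurable_dStar, measurable_dStar, measurable_edist]
  rcases hp.eq_or_lt with rfl | hp'
  · simp
  have hpq := Real.HolderConjugate.conjExponent hp'
  have he : 1 - 1 / p = 1 / p.conjExponent := by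
    rw [one_div, one_div, hpq.symm.one_sub_inv.symm]
    simp
  have hp0 : p ≠ 0 := by positivity
  have hq0 : p.conjExponent ≠ 0 := hpq.symm.ne_zero
  rw [hcost, hcost]
  calc ∑ i, ∫⁻ z, f i z ^ (1 : ℝ) ∂m i
      ≤ ∑ i, (∫⁻ z, f i z ^ p ∂m i) ^ (1 / p) * m i univ ^ (1 / p.conjExponent) := by
        refine Finset.sum_le_sum fun i _ => ?_
        simpa only [ENNReal.rpow_one, he] using lintegral_rpow_one_le hp (m i) (hf i)
    _ ≤ _ := ENNReal.inner_le_Lp_mul_Lq _ _ _ hpq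
    _ = _ := by
        simp_rw [← ENNReal.rpow_mul, one_div_mul_cancel hp0, one_div_mul_cancel hq0,
          ENNReal.rpow_one, hm, ENNReal.one_rpow, mul_one]

open Completion'

theorem SubProb.map_collapse (μ : SubProb Y) :
    (μ.1.map Subtype.val).map (collapse Y) = μ.1.map pt := by
  rw [Measure.map_map continuous_collapse.measurable measurable_subtype_coe]
  congr 1
  ext x
  exact collapse_coe x

theorem SubProb.extend_univ (μ : SubProb Y) : μ.extend univ = 1 := by
  simp only [SubProb.extend, Measure.add_apply, Measure.smul_apply, smul_eq_mul, measure_univ,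
    mul_one, Measure.map_apply continuous_pt.measurable .univ, preimage_univ]
  exact add_tsub_cancel_of_le μ.2

instance (μ : SubProb Y) : IsProbabilityMeasure μ.extend := ⟨μ.extend_univ⟩

theorem lintegral_edist_cemetery_extend (μ : SubProb Y) :
    ∫⁻ a, edist a cemetery ∂μ.extend = ∫⁻ x, edist (pt x) cemetery ∂μ.1 := by
  have hm : Measurable fun a : Completion' Y => edist a cemetery := by fun_prop
  rw [SubProb.extend, lintegral_add_measure, lintegral_smul_measure, lintegral_dirac' _ hm,
    lintegral_map hm continuous_pt.measurable]
  simp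

/-- A charged plan induces, on the completion, a coupling of the extended measures up to common
mass: particles and antiparticles that stay so move forwards and backwards respectively, and a
particle that annihilates moves, together with its partner, to `∂`. Created pairs come from `∂`. -/
theorem exists_transportCost_extend_add_le [SecondCountableTopology X] (hne : Y ≠ univ)
    {σ τ : ChargedProb Y} {μ ν : SubProb Y} (hσ : σ.HasEffective μ) (hτ : τ.HasEffective ν)
    (π : ChargedPlan σ τ) :
    ∃ η : Measure (Completion' Y), IsFiniteMeasure η ∧
      transportCost (μ.extend + η) (ν.extend + η) ≤ π.cost 1 := by
  have := secondCountableTopology (Y := Y) hne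
  have := σ.isFiniteMeasure_pos
  have := σ.isFiniteMeasure_neg
  have := τ.isFiniteMeasure_pos
  have := τ.isFiniteMeasure_neg
  have hj : Measurable (collapse Y : X → Completion' Y) := continuous_collapse.measurable
  have hc : Measurable fun _ : X × X => (cemetery : Completion' Y) := measurable_const
  have h1 : Measurable fun z : X × X => collapse Y z.1 := hj.comp measurable_fst
  have h2 : Measurable fun z : X × X => collapse Y z.2 := hj.comp measurable_snd
  have hη : IsFiniteMeasure ((2 * π.mp univ + μ.1 univ) •
      Measure.dirac (cemetery : Completion' Y)) := by
    refine (Measure.dirac _).smul_finite (ne_top_of_le_ne_top (b := 2 * 1 + 1) (by finiteness) ?_)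
    gcongr
    · rw [← π.univ_eq, add_right_comm]; exact le_add_self
    · exact μ.2
  refine ⟨σ.neg.map (collapse Y) + τ.neg.map (collapse Y) +
    (2 * π.mp univ + μ.1 univ) • Measure.dirac cemetery, inferInstance, ?_⟩
  -- the effective masses differ by twice the mass that changes sign: a particle that turns into an
  -- antiparticle lowers the effective mass by two units
  have hmass : 2 * π.mp univ + μ.1 univ = 2 * π.pm univ + ν.1 univ := by
    have e1 := congrArg (fun m : Measure X => m univ) (π.fst_pos.trans hσ)
    have e2 := congrArg (fun m : Measure X => m univ) (π.snd_pos.trans hτ)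
    rw [← π.fst_neg] at e1
    rw [← π.snd_neg] at e2
    simp only [Measure.add_apply, SubProb.map_coe_univ] at e1 e2
    simp only [Measure.map_apply measurable_fst .univ, Measure.map_apply measurable_snd .univ,
      preimage_univ] at e1 e2
    have hfin : π.pp univ + π.mm univ ≠ ∞ := by
      refine ne_top_of_le_ne_top ENNReal.one_ne_top (b := 1) ?_
      rw [← π.univ_eq]
      calc π.pp univ + π.mm univ ≤ π.pp univ + π.mm univ + (π.pm univ + π.mp univ) := le_self_add
        _ = _ := by ring
    refine (ENNReal.add_right_inj hfin).1 ?_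
    calc π.pp univ + π.mm univ + (2 * π.mp univ + μ.1 univ)
        = (π.pp univ + π.mp univ) + (π.mp univ + π.mm univ + μ.1 univ) := by ring
      _ = (π.pm univ + π.mm univ + ν.1 univ) + (π.pp univ + π.pm univ) := by rw [e1, e2]
      _ = _ := by ring
  have hext : ∀ (ρ : SubProb Y) (s : ℝ≥0∞) (α β : Measure (Completion' Y)),
      ρ.extend + (α + β + (s + ρ.1 univ) • Measure.dirac cemetery) =
        (ρ.1.map Subtype.val).map (collapse Y) + α + β + s • Measure.dirac cemetery +
          Measure.dirac cemetery := by
    intro ρ s α β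
    rw [SubProb.extend, ρ.map_collapse]
    have : Measure.dirac (cemetery : Completion' Y) =
        (1 - ρ.1 univ) • Measure.dirac cemetery + ρ.1 univ • Measure.dirac cemetery := by
      rw [← add_smul, tsub_add_cancel_of_le ρ.2, one_smul]
    conv_rhs => arg 2; rw [this]
    rw [add_smul]
    abel
  have hconst : ∀ m : Measure (X × X), m.map (fun _ => (cemetery : Completion' Y)) +
      m.map (fun _ => (cemetery : Completion' Y)) = (2 * m univ) • Measure.dirac cemetery := by
    intro m
    rw [Measure.map_const, ← add_smul, two_mul]
  have hS : μ.extend + (σ.neg.map (collapse Y) + τ.neg.map (collapse Y) +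
      (2 * π.mp univ + μ.1 univ) • Measure.dirac cemetery) =
      π.pp.map (fun z => collapse Y z.1) + (π.pm.map (fun z => collapse Y z.1) +
        π.pm.map (fun z => collapse Y z.2)) + (π.mp.map (fun _ => cemetery) +
        π.mp.map (fun _ => cemetery)) + π.mm.map (fun z => collapse Y z.2) +
        Measure.dirac cemetery := by
    rw [hext, ← Measure.map_add _ _ hj, add_comm (μ.1.map Subtype.val), ← hσ, ← π.fst_pos,
      ← π.snd_neg, Measure.map_add _ _ hj, Measure.map_add _ _ hj,
      Measure.map_map hj measurable_fst, Measure.map_map hj measurable_fst,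
      Measure.map_map hj measurable_snd, Measure.map_map hj measurable_snd, hconst]
    simp only [Function.comp_def]
    abel
  have hT : ν.extend + (σ.neg.map (collapse Y) + τ.neg.map (collapse Y) +
      (2 * π.mp univ + μ.1 univ) • Measure.dirac cemetery) =
      π.pp.map (fun z => collapse Y z.2) + (π.pm.map (fun _ => cemetery) +
        π.pm.map (fun _ => cemetery)) + (π.mp.map (fun z => collapse Y z.1) +
        π.mp.map (fun z => collapse Y z.2)) + π.mm.map (fun z => collapse Y z.1) +
        Measure.dirac cemetery := by
    rw [hmass, add_comm (σ.neg.map _), hext, ← Measure.map_add _ _ hj,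
      add_comm (ν.1.map Subtype.val), ← hτ, ← π.snd_pos,
      ← π.fst_neg, Measure.map_add _ _ hj, Measure.map_add _ _ hj,
      Measure.map_map hj measurable_fst, Measure.map_map hj measurable_fst,
      Measure.map_map hj measurable_snd, Measure.map_map hj measurable_snd, hconst]
    simp only [Function.comp_def]
    abel
  rw [hS, hT]
  refine (transportCost_add_le _ _ _ _).trans ?_
  rw [transportCost_self, add_zero]
  refine (transportCost_add_le _ _ _ _).trans (add_le_add ?_ ?_)
  · refine (transportCost_add_le _ _ _ _).trans (add_le_add ?_ ?_)
    · refine (transportCost_add_le _ _ _ _).trans (add_le_add ?_ ?_)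
      · refine (transportCost_map_map_le π.pp h1 h2).trans (lintegral_mono fun z => ?_)
        simpa using edist_collapse_le z.1 z.2
      · refine (transportCost_add_le _ _ _ _).trans ((add_le_add
          (transportCost_map_map_le π.pm h1 hc) (transportCost_map_map_le π.pm h2 hc)).trans ?_)
        rw [← lintegral_add_left (by fun_prop)]
        refine lintegral_mono fun z => ?_
        simpa using edist_cemetery_add_le_dStar z.1 z.2
    · refine (transportCost_add_le _ _ _ _).trans ((add_le_add
        (transportCost_map_map_le π.mp hc h1) (transportCost_map_map_le π.mp hc h2)).trans ?_)
      rw [← lintegral_add_left (by fun_prop)]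
      refine lintegral_mono fun z => ?_
      simp_rw [edist_comm cemetery, ENNReal.rpow_one]
      exact edist_cemetery_add_le_dStar z.1 z.2
  · refine (transportCost_map_map_le π.mm h2 h1).trans (lintegral_mono fun z => ?_)
    rw [edist_comm, ENNReal.rpow_one]
    exact edist_collapse_le z.1 z.2

/-- Finiteness of the `p`-th moment with respect to the ambient metric. It describes the
measures at finite pre-distance from some unit mass. -/
def SubProb.HasMoment (p : ℝ) (μ : SubProb Y) (y : X) : Prop :=
  ∫⁻ x : Y, edist (x : X) y ^ p ∂μ.1 ≠ ∞

/-- A charged probability measure that represents a unit mass on `Y` has no negative part, so that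
each plan to it transports all of `σ⁺` to that point without annihilation. -/
theorem exists_hasMoment_of_mem_subProbP [SecondCountableTopology X] {κ : PlanKind} {p : ℝ}
    (hp : 1 ≤ p) {μ : SubProb Y} (hμ : μ ∈ subProbP κ p Y) : ∃ y : Y, μ.HasMoment p y := by
  obtain ⟨y, hy⟩ := hμ
  refine ⟨y, ?_⟩
  simp only [wZero, iInf_lt_iff] at hy
  obtain ⟨σ, τ, hσ, hτ, hy⟩ := hy
  have hp0 : 0 < p := by linarith
  rw [wTilde, ENNReal.rpow_lt_top_iff_of_pos (by positivity)] at hy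
  simp only [iInf_lt_iff] at hy
  obtain ⟨π, -, hπ⟩ := hy
  have hyd : ((SubProb.dirac y).1.map Subtype.val : Measure X) = Measure.dirac (y : X) :=
    Measure.map_dirac' measurable_subtype_coe y
  have hm := τ.mass
  rw [hτ, hyd] at hm
  simp only [Measure.add_apply, measure_univ] at hm
  have hneg : τ.neg univ = 0 := by
    have : τ.neg univ + 1 ≤ 1 := le_self_add.trans_eq hm
    by_contra h
    rw [add_comm] at this
    exact absurd this (not_le.2 (ENNReal.lt_add_right ENNReal.one_ne_top h))
  rw [Measure.measure_univ_eq_zero] at hneg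
  have hpos : τ.pos = Measure.dirac (y : X) := by rw [hτ, hneg, zero_add, hyd]
  have hpm : π.pm = 0 := by
    have h := congrArg (fun m : Measure X => m univ) (π.snd_neg.trans hneg)
    simp only [Measure.add_apply, Measure.map_apply measurable_snd .univ, preimage_univ] at h
    exact Measure.measure_univ_eq_zero.1 (add_eq_zero.1 h).1
  have hpp : ∀ᵐ z ∂π.pp, z.2 = (y : X) := by
    have h : π.pp.map Prod.snd ≤ Measure.dirac (y : X) := by
      rw [← hpos, ← π.snd_pos]; exact Measure.le_add_right le_rfl
    have h' : ∀ᵐ x ∂(π.pp.map Prod.snd), x = (y : X) := by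
      refine (Measure.absolutelyContinuous_of_le h).ae_le ?_
      rw [ae_dirac_eq]
      rfl
    exact ae_of_ae_map measurable_snd.aemeasurable h'
  have hle : μ.1.map Subtype.val ≤ π.pp.map Prod.fst := by
    have h := π.fst_pos
    rw [hpm, Measure.map_zero, add_zero] at h
    rw [h, hσ]
    exact Measure.le_add_left le_rfl
  refine ne_top_of_le_ne_top hπ.ne ?_
  calc ∫⁻ x : Y, edist (x : X) y ^ p ∂μ.1
      = ∫⁻ x, edist x y ^ p ∂(μ.1.map Subtype.val) := by
        rw [lintegral_map (by fun_prop) measurable_subtype_coe]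
    _ ≤ ∫⁻ x, edist x y ^ p ∂(π.pp.map Prod.fst) := lintegral_mono' hle le_rfl
    _ = ∫⁻ z, edist z.1 y ^ p ∂π.pp := lintegral_map (by fun_prop) measurable_fst
    _ = ∫⁻ z, edist z.1 z.2 ^ p ∂π.pp := by
        refine lintegral_congr_ae ?_
        filter_upwards [hpp] with z hz
        rw [hz]
    _ ≤ π.cost p := by
        rw [ChargedPlan.cost, add_assoc, add_assoc]
        exact le_self_add

/-- In a probability space a `p`-th moment controls the first moment, whatever the base points. -/
theorem lintegral_edist_ne_top_of_hasMoment [SecondCountableTopology X] {p : ℝ} (hp : 1 ≤ p)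
    {μ : SubProb Y} {y : X} (hμ : μ.HasMoment p y) :
    ∫⁻ x : Y, edist (x : X) y ∂μ.1 ≠ ∞ := by
  refine ne_top_of_le_ne_top ?_ (lintegral_rpow_one_le hp μ.1 (by fun_prop))
  have hp0 : 0 < p := by linarith
  have h1 : 0 ≤ 1 - 1 / p := by rw [sub_nonneg, div_le_one hp0]; exact hp
  refine ENNReal.mul_ne_top (ENNReal.rpow_ne_top_of_nonneg (by positivity) hμ) ?_
  exact ENNReal.rpow_ne_top_of_nonneg h1 (ne_top_of_le_ne_top ENNReal.one_ne_top μ.2)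

theorem lintegral_edist_cemetery_ne_top [SecondCountableTopology X] (hne : Y ≠ univ) {p : ℝ}
    (hp : 1 ≤ p) {μ : SubProb Y} {y : X} (hμ : μ.HasMoment p y) :
    ∫⁻ a, edist a cemetery ∂μ.extend ≠ ∞ := by
  obtain ⟨z, hz⟩ := nonempty_compl.2 hne
  rw [lintegral_edist_cemetery_extend]
  refine ne_top_of_le_ne_top ?_ (lintegral_mono (g := fun x : Y => edist (x : X) y + edist y z)
    fun x => ?_)
  · rw [lintegral_add_right _ measurable_const, lintegral_const]
    exact ENNReal.add_ne_top.2 ⟨lintegral_edist_ne_top_of_hasMoment hp hμ,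
      ENNReal.mul_ne_top (edist_ne_top _ _) (ne_top_of_le_ne_top ENNReal.one_ne_top μ.2)⟩
  · rw [← collapse_coe, ← collapse_of_notMem hz]
    exact (edist_collapse_le _ _).trans (edist_triangle _ _ _)

variable [CompleteSpace X] [TopologicalSpace.SeparableSpace X]

theorem wPrime_one_le_wZero (hY : IsOpen Y) (hne : Y ≠ univ) {κ : PlanKind} {p : ℝ} (hp : 1 ≤ p)
    {μ ν : SubProb Y} (hμ : μ ∈ subProbP κ p Y) (hν : ν ∈ subProbP κ p Y) :
    wPrime 1 μ ν ≤ wZero κ p μ ν := by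
  have := UniformSpace.secondCountable_of_separable X
  have := secondCountableTopology (Y := Y) hne
  have := standardBorelSpace hY hne
  obtain ⟨y, hy⟩ := exists_hasMoment_of_mem_subProbP hp hμ
  obtain ⟨y', hy'⟩ := exists_hasMoment_of_mem_subProbP hp hν
  rw [wPrime, wasserstein_one]
  refine le_iInf₂ fun σ τ => le_iInf₂ fun hσ hτ => ?_
  have hp0 : 0 < p := by linarith
  rw [wTilde, one_div, ENNReal.le_rpow_inv_iff hp0]
  refine le_iInf₂ fun π _ => ?_
  rw [← ENNReal.le_rpow_inv_iff hp0, ← one_div]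
  refine le_trans ?_ (π.cost_one_le hp)
  obtain ⟨η, _, hη⟩ := exists_transportCost_extend_add_le hne hσ hτ π
  refine le_trans ?_ hη
  exact transportCost_le_transportCost_add cemetery (by simp)
    (lintegral_edist_cemetery_ne_top hne hp hy) (lintegral_edist_cemetery_ne_top hne hp hy') η

theorem wPrime_one_le_wFlat (hY : IsOpen Y) (hne : Y ≠ univ) {κ : PlanKind} {p : ℝ} (hp : 1 ≤ p)
    (μ ν : SubProb Y) : wPrime 1 μ ν ≤ wFlat κ p μ ν := by
  have := UniformSpace.secondCountable_of_separable X
  have := secondCountableTopology (Y := Y) hne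
  have := standardBorelSpace hY hne
  have : Nonempty (Completion' Y) := ⟨cemetery⟩
  refine le_iInf₂ fun n η => le_iInf fun hη => le_iInf₂ fun h0 h1 => ?_
  subst h0 h1
  induction n with
  | zero =>
    rw [wPrime, wasserstein_one, Fin.last_zero, transportCost_self]
    exact zero_le
  | succ n ih =>
    rw [Fin.sum_univ_castSucc]
    have h1 := ih (fun i => η i.castSucc) (fun i => hη _)
    have h2 := wPrime_one_le_wZero hY hne hp (hη (Fin.last n).castSucc) (hη (Fin.last n).succ)
    refine le_trans ?_ (add_le_add h1 h2)
    simp only [wPrime, wasserstein_one]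
    exact transportCost_triangle _ _ _

end Charged

/-! ### Measurable selection of almost shortest paths -/

section Paths

/-- The `n`-th dyadic refinement of the pair `z`, continued constantly to the right: the maps
`m k` supply the new points at level `k + 1`. -/
def dyadicChain {X : Type*} (m : ℕ → X × X → X) (z : X × X) : ℕ → ℕ → X
  | 0, j => if j = 0 then z.1 else z.2
  | n + 1, j => if Even j then dyadicChain m z n (j / 2) else
      m n (dyadicChain m z n (j / 2), dyadicChain m z n (j / 2 + 1))

variable {X : Type*} [MetricSpace X]

/-- On a curve of length less than `K · d(x,y)` some point is equidistant from both ends. -/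
theorem IsLengthSpace.exists_approx_midpoint (hX : IsLengthSpace X) {K : ℝ} (hK : 1 < K) {x y : X}
    (hxy : x ≠ y) : ∃ z, dist x z < K / 2 * dist x y ∧ dist z y < K / 2 * dist x y := by
  have hd : 0 < dist x y := dist_pos.2 hxy
  have hlt : (⨅ γ : Path x y, eVariationOn (fun t : unitInterval => γ t) univ) <
      ENNReal.ofReal (K * dist x y) := by
    rw [← hX x y, edist_dist]
    exact (ENNReal.ofReal_lt_ofReal_iff (by positivity)).2 (by nlinarith)
  obtain ⟨γ, hγ⟩ := iInf_lt_iff.1 hlt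
  have hcont : Continuous fun t : unitInterval => dist x (γ t) - dist (γ t) y := by fun_prop
  obtain ⟨t, ht⟩ := mem_range_of_exists_le_of_exists_ge hcont (c := 0)
    ⟨0, by simp⟩ ⟨1, by simp⟩
  have hlen : edist x (γ t) + edist (γ t) y ≤ eVariationOn (fun t : unitInterval => γ t) univ := by
    have h := eVariationOn.Icc_add_Icc (fun t : unitInterval => γ t) (s := univ) (a := 0) (b := t)
      (c := 1) t.2.1 t.2.2 (mem_univ _)
    refine le_trans ?_ (h.trans_le (eVariationOn.mono _ inter_subset_left))
    refine add_le_add ?_ ?_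
    · simpa using eVariationOn.edist_le (fun t : unitInterval => γ t) (s := univ ∩ Icc 0 t)
        (x := 0) (y := t) ⟨mem_univ _, le_rfl, t.2.1⟩ ⟨mem_univ _, t.2.1, le_rfl⟩
    · simpa using eVariationOn.edist_le (fun t : unitInterval => γ t) (s := univ ∩ Icc t 1)
        (x := t) (y := 1) ⟨mem_univ _, le_rfl, t.2.2⟩ ⟨mem_univ _, t.2.2, le_rfl⟩
  have hsum : dist x (γ t) + dist (γ t) y < K * dist x y := by
    have h := hlen.trans_lt hγ
    rw [edist_dist, edist_dist, ← ENNReal.ofReal_add dist_nonneg dist_nonneg] at h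
    exact (ENNReal.ofReal_lt_ofReal_iff (by positivity)).1 h
  simp only at ht
  exact ⟨γ t, by linarith, by linarith⟩

variable [TopologicalSpace.SeparableSpace X] [MeasurableSpace X] [BorelSpace X]

/-- Approximate midpoints can be selected measurably. -/
theorem IsLengthSpace.exists_measurable_midpoint (hX : IsLengthSpace X) {K : ℝ} (hK : 1 < K) :
    ∃ m : X × X → X, Measurable m ∧ ∀ z, dist z.1 (m z) ≤ K / 2 * dist z.1 z.2 ∧
      dist (m z) z.2 ≤ K / 2 * dist z.1 z.2 := by
  classical
  have := UniformSpace.secondCountable_of_separable X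
  rcases isEmpty_or_nonempty X with hE | hE
  · exact ⟨Prod.fst, measurable_fst, fun z => hE.elim z.1⟩
  let f : ℕ → X × X → X := fun n => n.casesOn Prod.fst fun i _ => TopologicalSpace.denseSeq X i
  have hf : ∀ n, Measurable (f n) := by
    rintro (_ | n)
    exacts [measurable_fst, measurable_const]
  let P : ℕ → X × X → Prop := fun n z => dist z.1 (f n z) ≤ K / 2 * dist z.1 z.2 ∧
      dist (f n z) z.2 ≤ K / 2 * dist z.1 z.2
  have hP : ∀ z, ∃ n, P n z := by
    rintro ⟨x, y⟩
    by_cases hxy : x = y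
    · exact ⟨0, by simp [P, f, hxy]⟩
    · obtain ⟨w, h1, h2⟩ := hX.exists_approx_midpoint hK hxy
      have ho : IsOpen {w | dist x w < K / 2 * dist x y ∧ dist w y < K / 2 * dist x y} :=
        IsOpen.and (isOpen_lt (by fun_prop) (by fun_prop)) (isOpen_lt (by fun_prop) (by fun_prop))
      obtain ⟨i, hi⟩ := (TopologicalSpace.denseRange_denseSeq X).exists_mem_open ho ⟨w, h1, h2⟩
      exact ⟨i + 1, hi.1.le, hi.2.le⟩
  refine ⟨fun z => f (Nat.find (hP z)) z, Measurable.find hf (fun n => ?_) hP,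
    fun z => Nat.find_spec (hP z)⟩
  have := hf n
  exact MeasurableSet.inter (s₁ := {z : X × X | dist z.1 (f n z) ≤ K / 2 * dist z.1 z.2})
    (s₂ := {z : X × X | dist (f n z) z.2 ≤ K / 2 * dist z.1 z.2})
    (measurableSet_le (by fun_prop) (by fun_prop)) (measurableSet_le (by fun_prop) (by fun_prop))

/-- Points of a closed set at almost minimal distance can be selected measurably. -/
theorem exists_measurable_foot {C : Set X} (hC : IsClosed C) (hne : C.Nonempty) {K : ℝ}
    (hK : 1 < K) :
    ∃ f : X → X, Measurable f ∧ ∀ x, f x ∈ C ∧ dist x (f x) ≤ K * Metric.infDist x C := by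
  classical
  have := UniformSpace.secondCountable_of_separable X
  have := hne.to_subtype
  let f : ℕ → X → X := fun n => n.casesOn id fun i _ => (TopologicalSpace.denseSeq C i : X)
  have hf : ∀ n, Measurable (f n) := by
    rintro (_ | n)
    exacts [measurable_id, measurable_const]
  let P : ℕ → X → Prop := fun n x => f n x ∈ C ∧ dist x (f n x) ≤ K * Metric.infDist x C
  have hP : ∀ x, ∃ n, P n x := by
    intro x
    by_cases hx : x ∈ C
    · exact ⟨0, hx, by simpa [f] using mul_nonneg (by linarith) Metric.infDist_nonneg⟩
    · have hpos := (hC.notMem_iff_infDist_pos hne).1 hx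
      obtain ⟨w, hw, hlt⟩ := (Metric.infDist_lt_iff hne).1
        (show Metric.infDist x C < K * Metric.infDist x C by nlinarith)
      have ho : IsOpen {w : C | dist x w < K * Metric.infDist x C} :=
        isOpen_lt (by fun_prop) (by fun_prop)
      obtain ⟨i, hi⟩ := (TopologicalSpace.denseRange_denseSeq C).exists_mem_open ho ⟨⟨w, hw⟩, hlt⟩
      exact ⟨i + 1, Subtype.coe_prop _, le_of_lt hi⟩
  refine ⟨fun x => f (Nat.find (hP x)) x, Measurable.find hf (fun n => ?_) hP,
    fun x => Nat.find_spec (hP x)⟩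
  exact (hf n hC.measurableSet).inter (measurableSet_le (measurable_id.dist (hf n))
    ((Metric.continuous_infDist_pt C).measurable.const_mul K))

variable [CompleteSpace X]

/-- Almost shortest paths of constant speed can be selected measurably. -/
theorem IsLengthSpace.exists_measurable_path (hX : IsLengthSpace X) {K : ℝ} (hK : 1 < K) :
    ∃ P : ℝ → X × X → X, (∀ t, Measurable (P t)) ∧ (∀ t ≤ 0, ∀ z, P t z = z.1) ∧
      (∀ t, 1 ≤ t → ∀ z, P t z = z.2) ∧
      ∀ s t z, dist (P s z) (P t z) ≤ K * dist z.1 z.2 * |s - t| := by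
  have := UniformSpace.secondCountable_of_separable X
  have hK0 : 0 < K := by linarith
  -- the relative errors of the midpoints at the successive levels multiply to at most `K`
  let c : ℕ → ℝ := fun k => K ^ ((1 / 2 : ℝ) ^ (k + 1))
  have hc : ∀ k, 1 < c k := fun k => Real.one_lt_rpow hK (by positivity)
  choose m hm hmd using fun k => hX.exists_measurable_midpoint (hc k)
  let D : ℕ → ℝ := fun n => K ^ (1 - (1 / 2 : ℝ) ^ n)
  have hD0 : D 0 = 1 := by simp [D]
  have hDs : ∀ n, D (n + 1) = c n * D n := fun n => by
    simp only [D, c]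
    rw [← Real.rpow_add hK0]
    congr 1
    ring
  have hDK : ∀ n, D n ≤ K := fun n => by
    calc D n ≤ K ^ (1 : ℝ) := Real.rpow_le_rpow_of_exponent_le hK.le (by
          have : (0 : ℝ) < (1 / 2) ^ n := by positivity
          linarith)
      _ = K := Real.rpow_one K
  -- `G z n j` is the position at time `j / 2 ^ n`, with rest at `z.2` after time `1`
  let G : X × X → ℕ → ℕ → X := dyadicChain m
  have hG0 : ∀ z n, G z n 0 = z.1 := by
    intro z n
    induction n with
    | zero => simp [G, dyadicChain]
    | succ n ih => simpa [G, dyadicChain] using ih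
  have hG1 : ∀ z n j, 2 ^ n ≤ j → G z n j = z.2 := by
    intro z n
    induction n with
    | zero => intro j hj; simp [G, dyadicChain, Nat.one_le_iff_ne_zero.1 hj]
    | succ n ih =>
      intro j hj
      rw [pow_succ] at hj
      have h1 := ih (j / 2) (by omega)
      have h2 := ih (j / 2 + 1) (by omega)
      simp only [G, dyadicChain] at h1 h2 ⊢
      split_ifs
      · exact h1
      · have h3 := (hmd n (z.2, z.2)).1
        simp only [dist_self, mul_zero] at h3
        rw [h1, h2, ← dist_le_zero.1 h3]
  have hGm : ∀ n j, Measurable fun z => G z n j := by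
    intro n
    induction n with
    | zero =>
      intro j
      simp only [G, dyadicChain]
      split_ifs
      exacts [measurable_fst, measurable_snd]
    | succ n ih =>
      intro j
      simp only [G, dyadicChain]
      split_ifs
      exacts [ih _, (hm n).comp ((ih _).prodMk (ih _))]
  have hGd : ∀ z n j, dist (G z n j) (G z n (j + 1)) ≤ D n / 2 ^ n * dist z.1 z.2 := by
    intro z n
    induction n with
    | zero =>
      rintro (_ | j)
      · simp [G, dyadicChain, hD0]
      · simp [G, dyadicChain, hD0]
    | succ n ih =>
      intro j
      have hmul : ∀ i, c n / 2 * dist (G z n i) (G z n (i + 1)) ≤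
          D (n + 1) / 2 ^ (n + 1) * dist z.1 z.2 := fun i => by
        calc c n / 2 * dist (G z n i) (G z n (i + 1))
            ≤ c n / 2 * (D n / 2 ^ n * dist z.1 z.2) :=
              mul_le_mul_of_nonneg_left (ih i) (by linarith [hc n])
          _ = _ := by rw [hDs, pow_succ]; field_simp
      rcases Nat.even_or_odd' j with ⟨i, rfl | rfl⟩
      · have e : G z (n + 1) (2 * i + 1) = m n (G z n i, G z n (i + 1)) := by
          simp [G, dyadicChain, show (2 * i + 1) / 2 = i by omega]
        have e' : G z (n + 1) (2 * i) = G z n i := by simp [G, dyadicChain]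
        rw [e, e']
        exact (hmd n (G z n i, G z n (i + 1))).1.trans (hmul i)
      · have e : G z (n + 1) (2 * i + 1) = m n (G z n i, G z n (i + 1)) := by
          simp [G, dyadicChain, show (2 * i + 1) / 2 = i by omega]
        have e' : G z (n + 1) (2 * i + 1 + 1) = G z n (i + 1) := by
          rw [show 2 * i + 1 + 1 = 2 * (i + 1) by ring]
          simp [G, dyadicChain]
        rw [e, e']
        exact (hmd n (G z n i, G z n (i + 1))).2.trans (hmul i)
  have hGK : ∀ z n j, dist (G z n j) (G z n (j + 1)) ≤ K * dist z.1 z.2 / 2 ^ n := fun z n j => by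
    refine (hGd z n j).trans ?_
    rw [div_mul_eq_mul_div]
    gcongr
    exact hDK n
  have hstep : ∀ z n j, dist (G z n (j / 2)) (G z (n + 1) j) ≤ K * dist z.1 z.2 / 2 / 2 ^ n := by
    intro z n j
    rw [div_div, ← pow_succ']
    refine le_trans ?_ (hGK z (n + 1) (2 * (j / 2)))
    have e' : G z (n + 1) (2 * (j / 2)) = G z n (j / 2) := by simp [G, dyadicChain]
    rw [e']
    rcases Nat.even_or_odd' j with ⟨i, rfl | rfl⟩
    · rw [show 2 * i / 2 = i by omega] at e' ⊢
      rw [e', dist_self]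
      exact dist_nonneg
    · rw [show 2 * ((2 * i + 1) / 2) = 2 * i by omega]
  have hfar : ∀ z n, ∀ i j : ℕ,
      dist (G z n i) (G z n j) ≤ |(i : ℝ) - j| * (K * dist z.1 z.2 / 2 ^ n) := by
    have key : ∀ z n, ∀ i j : ℕ, i ≤ j →
        dist (G z n i) (G z n j) ≤ |(i : ℝ) - j| * (K * dist z.1 z.2 / 2 ^ n) := by
      intro z n i j hij
      refine (dist_le_Ico_sum_of_dist_le (f := G z n) hij fun _ _ => hGK z n _).trans_eq ?_
      rw [Finset.sum_const, Nat.card_Ico, nsmul_eq_mul, Nat.cast_sub hij, abs_sub_comm,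
        abs_of_nonneg (by rw [sub_nonneg]; exact_mod_cast hij)]
    intro z n i j
    rcases le_total i j with h | h
    · exact key z n i j h
    · rw [dist_comm, abs_sub_comm]; exact key z n j i h
  -- the paths that jump at the multiples of `2 ^ (-n)` only converge by completeness
  let Q : ℕ → ℝ → X × X → X := fun n t z => G z n ⌊2 ^ n * t⌋₊
  have hcau : ∀ t z, CauchySeq fun n => Q n t z := fun t z => by
    refine cauchySeq_of_le_geometric_two (C := K * dist z.1 z.2) fun n => ?_
    have e : ⌊2 ^ n * t⌋₊ = ⌊2 ^ (n + 1) * t⌋₊ / 2 := by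
      have := Nat.floor_div_natCast (2 ^ (n + 1) * t) 2
      rw [← this]
      congr 1
      push_cast
      ring
    simp only [Q]
    rw [e]
    exact hstep z n _
  choose P hP using fun t z => cauchySeq_tendsto_of_complete (hcau t z)
  have hfloor : ∀ a b : ℝ, |(⌊a⌋₊ : ℝ) - ⌊b⌋₊| ≤ |a - b| + 1 := by
    have key : ∀ a b : ℝ, (⌊a⌋₊ : ℝ) - ⌊b⌋₊ ≤ |a - b| + 1 := by
      intro a b
      have hb := Nat.lt_floor_add_one b
      have hb0 : (0 : ℝ) ≤ ⌊b⌋₊ := Nat.cast_nonneg _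
      rcases le_total 0 a with h | h
      · have := Nat.floor_le h
        have := le_abs_self (a - b)
        linarith
      · rw [Nat.floor_of_nonpos h, Nat.cast_zero]
        have := abs_nonneg (a - b)
        linarith
    intro a b
    refine abs_le.2 ⟨?_, key a b⟩
    have := key b a
    rw [abs_sub_comm] at this
    linarith
  refine ⟨P, fun t => measurable_of_tendsto_metrizable (fun n => hGm n _)
    (tendsto_pi_nhds.2 fun z => hP t z), fun t ht z => ?_, fun t ht z => ?_, fun s t z => ?_⟩
  · refine tendsto_nhds_unique (hP t z) (tendsto_const_nhds.congr fun n => ?_)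
    simp only [Q]
    rw [Nat.floor_of_nonpos (mul_nonpos_of_nonneg_of_nonpos (by positivity) ht), hG0]
  · refine tendsto_nhds_unique (hP t z) (tendsto_const_nhds.congr fun n => ?_)
    refine (hG1 z n _ (Nat.le_floor ?_)).symm
    push_cast
    nlinarith [show (0 : ℝ) < 2 ^ n by positivity]
  · have hlim : Tendsto (fun n : ℕ => K * dist z.1 z.2 * (|s - t| + (1 / 2) ^ n)) atTop
        (𝓝 (K * dist z.1 z.2 * (|s - t| + 0))) :=
      (tendsto_const_nhds.add (tendsto_pow_atTop_nhds_zero_of_lt_one (by norm_num)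
        (by norm_num))).const_mul _
    rw [add_zero] at hlim
    refine le_of_tendsto_of_tendsto' ((hP s z).dist (hP t z)) hlim fun n => ?_
    refine (hfar z n _ _).trans ?_
    calc |(⌊2 ^ n * s⌋₊ : ℝ) - ⌊2 ^ n * t⌋₊| * (K * dist z.1 z.2 / 2 ^ n)
        ≤ (|2 ^ n * s - 2 ^ n * t| + 1) * (K * dist z.1 z.2 / 2 ^ n) := by
          gcongr
          exact hfloor _ _
      _ = _ := by
          rw [← mul_sub, abs_mul, abs_of_pos (show (0 : ℝ) < 2 ^ n by positivity), one_div, inv_pow]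
          field_simp

end Paths

/-! ### Chains and Lipschitz curves -/

section FlatDistance

variable {X : Type*} [MetricSpace X] [MeasurableSpace X] {Y : Set X} {κ : PlanKind} {p : ℝ}

theorem wFlat_le_of_chain {n : ℕ} (η : Fin (n + 1) → SubProb Y) (h : ∀ i, η i ∈ subProbP κ p Y) :
    wFlat κ p (η 0) (η (Fin.last n)) ≤ ∑ i : Fin n, wZero κ p (η i.castSucc) (η i.succ) :=
  iInf₂_le_of_le n η (iInf_le_of_le h (iInf_le_of_le rfl (iInf_le _ rfl)))

theorem wFlat_self {μ : SubProb Y} (hμ : μ ∈ subProbP κ p Y) : wFlat κ p μ μ = 0 := by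
  have h := wFlat_le_of_chain (κ := κ) (p := p) (n := 0) (fun _ => μ) fun _ => hμ
  simpa using h

theorem wFlat_le_wFlat_add_wZero {μ ν ξ : SubProb Y} (hξ : ξ ∈ subProbP κ p Y) :
    wFlat κ p μ ξ ≤ wFlat κ p μ ν + wZero κ p ν ξ := by
  conv_rhs => unfold wFlat
  simp_rw [ENNReal.iInf_add]
  refine le_iInf₂ fun n η => le_iInf fun hη => le_iInf₂ fun h0 h1 => ?_
  have h := wFlat_le_of_chain (κ := κ) (p := p) (n := n + 1)
    (Fin.snoc (α := fun _ => SubProb Y) η ξ)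
    (Fin.lastCases (by simpa using hξ) fun i => by simpa using hη i)
  rw [Fin.sum_univ_castSucc] at h
  simp only [Fin.snoc_last, Fin.snoc_castSucc, ← Fin.castSucc_succ, Fin.succ_last] at h
  rw [show (0 : Fin (n + 1 + 1)) = Fin.castSucc 0 from rfl, Fin.snoc_castSucc, h0, h1] at h
  exact h

theorem wFlat_le_wZero_add_wFlat {μ ν ξ : SubProb Y} (hμ : μ ∈ subProbP κ p Y) :
    wFlat κ p μ ξ ≤ wZero κ p μ ν + wFlat κ p ν ξ := by
  conv_rhs => unfold wFlat
  simp_rw [ENNReal.add_iInf]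
  refine le_iInf₂ fun n η => le_iInf fun hη => le_iInf₂ fun h0 h1 => ?_
  have h := wFlat_le_of_chain (κ := κ) (p := p) (n := n + 1)
    (Fin.cons (α := fun _ => SubProb Y) μ η)
    (Fin.cases (by simpa using hμ) fun i => by simpa using hη i)
  rw [Fin.sum_univ_succ] at h
  simp only [Fin.cons_zero, Fin.castSucc_zero, Fin.cons_succ, ← Fin.succ_castSucc,
    ← Fin.succ_last, h0, h1] at h
  exact h

theorem wFlat_le_wZero {μ ν : SubProb Y} (hμ : μ ∈ subProbP κ p Y) (hν : ν ∈ subProbP κ p Y) :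
    wFlat κ p μ ν ≤ wZero κ p μ ν := by
  simpa [wFlat_self hμ] using wFlat_le_wFlat_add_wZero (μ := μ) (ν := μ) hν

theorem wFlat_le_wSharp (μ ν : SubProb Y) : wFlat κ p μ ν ≤ wSharp κ p μ ν := by
  refine le_iInf₂ fun η hη => le_iInf fun _ => le_iInf₂ fun h0 h1 => ?_
  refine le_iSup_of_le 1 (le_iSup_of_le ![0, 1] (le_iSup₂_of_le ?_ rfl (le_iSup_of_le rfl ?_)))
  · intro i j hij
    fin_cases i <;> fin_cases j <;> simp_all
  · simp [h0, h1]

/-- Lipschitz bounds for `W⁰_p` on the pieces of a uniform partition of `[0, 1]` add up to a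
Lipschitz bound for `W♭_p`. -/
theorem wFlat_le_of_piecewise {N : ℕ} {η : ℝ → SubProb Y} {A : ℝ≥0∞}
    (hη : ∀ t ∈ Icc (0 : ℝ) 1, η t ∈ subProbP κ p Y)
    (h : ∀ k < N, ∀ s ∈ Icc (k / N : ℝ) ((k + 1) / N), ∀ t ∈ Icc (k / N : ℝ) ((k + 1) / N),
      wZero κ p (η s) (η t) ≤ A * ENNReal.ofReal |s - t|) (hN : 0 < N) :
    ∀ s ∈ Icc (0 : ℝ) 1, ∀ t ∈ Icc (0 : ℝ) 1,
      wFlat κ p (η s) (η t) ≤ A * ENNReal.ofReal |s - t| := by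
  have hN' : (0 : ℝ) < N := by exact_mod_cast hN
  have key : ∀ k ≤ N, ∀ s ∈ Icc (0 : ℝ) (k / N), ∀ t ∈ Icc (0 : ℝ) (k / N),
      wFlat κ p (η s) (η t) ≤ A * ENNReal.ofReal |s - t| := by
    intro k
    induction k with
    | zero =>
      intro _ s hs t ht
      simp only [Nat.cast_zero, zero_div, Icc_self, mem_singleton_iff] at hs ht
      rw [hs, ht, wFlat_self (hη 0 (by simp))]
      exact zero_le
    | succ k ih =>
      intro hk s hs t ht
      rw [Nat.cast_add_one] at hs ht
      have hk1 : ((k : ℝ) + 1) / N ≤ 1 := by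
        rw [div_le_one hN']; exact_mod_cast hk
      have hmid0 : (0 : ℝ) ≤ k / N := by positivity
      have hmid : (k / N : ℝ) ∈ Icc (k / N : ℝ) ((k + 1) / N) :=
        ⟨le_rfl, by gcongr; linarith⟩
      have hsη := hη s ⟨hs.1, hs.2.trans hk1⟩
      have htη := hη t ⟨ht.1, ht.2.trans hk1⟩
      have hsplit : ∀ a b c : ℝ, a ≤ b → b ≤ c →
          A * ENNReal.ofReal (b - a) + A * ENNReal.ofReal (c - b) = A * ENNReal.ofReal (c - a) := by
        intro a b c hab hbc
        rw [← mul_add, ← ENNReal.ofReal_add (by linarith) (by linarith)]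
        congr 2
        ring
      rcases le_total s (k / N) with hs' | hs' <;> rcases le_total t (k / N) with ht' | ht'
      · exact ih (by omega) s ⟨hs.1, hs'⟩ t ⟨ht.1, ht'⟩
      · refine (wFlat_le_wFlat_add_wZero (ν := η (k / N)) htη).trans ((add_le_add
          (ih (by omega) s ⟨hs.1, hs'⟩ _ ⟨hmid0, le_rfl⟩) (h k hk _ hmid t ⟨ht', ht.2⟩)).trans ?_)
        rw [abs_sub_comm s (k / N), abs_sub_comm (k / N : ℝ) t, abs_sub_comm s t,
          abs_of_nonneg (sub_nonneg.2 hs'), abs_of_nonneg (sub_nonneg.2 ht'),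
          abs_of_nonneg (sub_nonneg.2 (hs'.trans ht')), hsplit _ _ _ hs' ht']
      · refine (wFlat_le_wZero_add_wFlat (ν := η (k / N)) hsη).trans ((add_le_add
          (h k hk s ⟨hs', hs.2⟩ _ hmid) (ih (by omega) _ ⟨hmid0, le_rfl⟩ t ⟨ht.1, ht'⟩)).trans ?_)
        rw [abs_of_nonneg (sub_nonneg.2 hs'), abs_of_nonneg (sub_nonneg.2 ht'),
          abs_of_nonneg (sub_nonneg.2 (ht'.trans hs')), add_comm, hsplit _ _ _ ht' hs']
      · exact (wFlat_le_wZero hsη htη).trans (h k hk s ⟨hs', hs.2⟩ t ⟨ht', ht.2⟩)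
  intro s hs t ht
  have h1 : ((N : ℕ) : ℝ) / N = 1 := div_self hN'.ne'
  exact key N le_rfl s (by rwa [h1]) t (by rwa [h1])

/-- A Lipschitz curve bounds `W♯_p`. -/
theorem wSharp_le_of_lipschitz {η : ℝ → SubProb Y} {A : ℝ≥0∞} (hA : A ≠ ∞)
    (hη : ∀ t ∈ Icc (0 : ℝ) 1, η t ∈ subProbP κ p Y)
    (h : ∀ s ∈ Icc (0 : ℝ) 1, ∀ t ∈ Icc (0 : ℝ) 1,
      wFlat κ p (η s) (η t) ≤ A * ENNReal.ofReal |s - t|) :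
    wSharp κ p (η 0) (η 1) ≤ A := by
  refine iInf₂_le_of_le (fun t : unitInterval => η t) (fun t => hη t t.2)
    (iInf_le_of_le (fun s => ?_) (iInf₂_le_of_le (by simp) (by simp) ?_))
  · have hlim : Tendsto (fun t : unitInterval => A * ENNReal.ofReal |(s : ℝ) - t|) (𝓝 s)
        (𝓝 (A * ENNReal.ofReal |(s : ℝ) - s|)) := by
      refine ENNReal.Tendsto.const_mul ?_ (Or.inr hA)
      exact (ENNReal.continuous_ofReal.comp (by fun_prop :
        Continuous fun t : unitInterval => |(s : ℝ) - t|)).tendsto s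
    rw [sub_self, abs_zero, ENNReal.ofReal_zero, mul_zero] at hlim
    exact tendsto_of_tendsto_of_tendsto_of_le_of_le tendsto_const_nhds hlim (fun _ => zero_le)
      fun t => h s s.2 t t.2
  · refine iSup₂_le fun n s => iSup_le fun hs => iSup₂_le fun h0 h1 => ?_
    have hnn : ∀ i : Fin n, (0 : ℝ) ≤ (s i.succ : ℝ) - s i.castSucc := fun i => by
      have h := hs.monotone (Fin.castSucc_le_succ i)
      exact sub_nonneg.2 h
    calc ∑ i : Fin n, wFlat κ p (η (s i.castSucc)) (η (s i.succ))
        ≤ ∑ i : Fin n, A * ENNReal.ofReal ((s i.succ : ℝ) - s i.castSucc) := by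
          refine Finset.sum_le_sum fun i _ => (h _ (s _).2 _ (s _).2).trans_eq ?_
          rw [abs_sub_comm, abs_of_nonneg (hnn i)]
      _ = A * ENNReal.ofReal (∑ i : Fin n, ((s i.succ : ℝ) - s i.castSucc)) := by
          rw [← Finset.mul_sum, ENNReal.ofReal_sum_of_nonneg]
          exact fun i _ => hnn i
      _ = A := by
          have htel : ∀ (n : ℕ) (f : Fin (n + 1) → ℝ),
              ∑ i : Fin n, (f i.succ - f i.castSucc) = f (Fin.last n) - f 0 := by
            intro n f
            have := (Fin.sum_univ_succ f).symm.trans (Fin.sum_univ_castSucc f)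
            rw [Finset.sum_sub_distrib]
            linarith
          rw [htel n fun i => (s i : ℝ), h0, h1]
          simp

end FlatDistance

/-! ### Mass that is neutral off `Y` -/

section Neutralize

section Weights

variable {X : Type*} {Y : Set X}

open Classical in
/-- The density of the positive part of the charged measure `neutralize m`. -/
noncomputable def posWeight (Y : Set X) (x : X) : ℝ≥0∞ := if x ∈ Y then 1 else 2⁻¹

open Classical in
/-- The density of the negative part of the charged measure `neutralize m`. -/
noncomputable def negWeight (Y : Set X) (x : X) : ℝ≥0∞ := if x ∈ Y then 0 else 2⁻¹

theorem posWeight_add_negWeight (x : X) : posWeight Y x + negWeight Y x = 1 := by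
  by_cases h : x ∈ Y <;> simp [posWeight, negWeight, h, ENNReal.inv_two_add_inv_two]

theorem negWeight_add_indicator (x : X) :
    negWeight Y x + Y.indicator 1 x = posWeight Y x := by
  by_cases h : x ∈ Y <;> simp [posWeight, negWeight, h]

end Weights

variable {X : Type*} [MeasurableSpace X] {Y : Set X}

theorem measurable_posWeight (hY : MeasurableSet Y) : Measurable (posWeight Y) :=
  Measurable.ite hY measurable_const measurable_const

theorem measurable_negWeight (hY : MeasurableSet Y) : Measurable (negWeight Y) :=
  Measurable.ite hY measurable_const measurable_const

theorem withDensity_posWeight_add (hY : MeasurableSet Y) (m : Measure X) :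
    m.withDensity (posWeight Y) + m.withDensity (negWeight Y) = m := by
  rw [← withDensity_add_left (measurable_posWeight hY),
    show posWeight Y + negWeight Y = 1 from funext posWeight_add_negWeight, withDensity_one]

/-- The charged probability measure with total measure `m` that is positive on `Y` and
neutral off `Y`. -/
noncomputable def neutralize (hY : MeasurableSet Y) (m : Measure X) [IsProbabilityMeasure m] :
    ChargedProb Y where
  pos := m.withDensity (posWeight Y)
  neg := m.withDensity (negWeight Y)
  restrict_eq := by
    rw [restrict_withDensity hY.compl, restrict_withDensity hY.compl]
    refine withDensity_congr_ae ((ae_restrict_iff' hY.compl).2 (ae_of_all _ fun x hx => ?_))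
    have hx' : x ∉ Y := hx
    simp [posWeight, negWeight, hx']
  mass := by
    rw [← Measure.add_apply, withDensity_posWeight_add hY, measure_univ]

theorem neutralize_total (hY : MeasurableSet Y) (m : Measure X) [IsProbabilityMeasure m] :
    (neutralize hY m).total = m := withDensity_posWeight_add hY m

theorem neutralize_hasEffective (hY : MeasurableSet Y) (m : Measure X) [IsProbabilityMeasure m]
    {μ : SubProb Y} (hμ : μ.1.map Subtype.val = m.restrict Y) :
    (neutralize hY m).HasEffective μ := by
  rw [ChargedProb.HasEffective, hμ]
  simp only [neutralize]
  rw [← withDensity_indicator_one hY, ← withDensity_add_left (measurable_negWeight hY),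
    show negWeight Y + Y.indicator 1 = posWeight Y from funext negWeight_add_indicator]

theorem withDensity_mul_add_map_fst {ρ : Measure (X × X)} {u v w : X → ℝ≥0∞} (hu : Measurable u)
    (hv : Measurable v) (h : ∀ x, v x + w x = 1) :
    (ρ.withDensity fun z => u z.1 * v z.2).map Prod.fst +
      (ρ.withDensity fun z => u z.1 * w z.2).map Prod.fst = (ρ.map Prod.fst).withDensity u := by
  rw [← Measure.map_add _ _ measurable_fst, ← withDensity_add_left (by fun_prop),
    ← withDensity_comp_map ρ measurable_fst hu]
  congr 2
  ext z
  simp [← mul_add, h]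

theorem withDensity_mul_add_map_snd {ρ : Measure (X × X)} {u v w : X → ℝ≥0∞} (hu : Measurable u)
    (hv : Measurable v) (h : ∀ x, v x + w x = 1) :
    (ρ.withDensity fun z => v z.1 * u z.2).map Prod.snd +
      (ρ.withDensity fun z => w z.1 * u z.2).map Prod.snd = (ρ.map Prod.snd).withDensity u := by
  rw [← Measure.map_add _ _ measurable_snd, ← withDensity_add_left (by fun_prop),
    ← withDensity_comp_map ρ measurable_snd hu]
  congr 2
  ext z
  simp [← add_mul, h]

/-- The canonical decomposition of a coupling of two measures whose charges are neutral off `Y`. -/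
noncomputable def neutralPlan (hY : MeasurableSet Y) {m₁ m₂ : Measure X} [IsProbabilityMeasure m₁]
    [IsProbabilityMeasure m₂] {ρ : Measure (X × X)} (hρ : IsCoupling m₁ m₂ ρ) :
    ChargedPlan (neutralize hY m₁) (neutralize hY m₂) where
  pp := ρ.withDensity fun z => posWeight Y z.1 * posWeight Y z.2
  pm := ρ.withDensity fun z => posWeight Y z.1 * negWeight Y z.2
  mp := ρ.withDensity fun z => negWeight Y z.1 * posWeight Y z.2
  mm := ρ.withDensity fun z => negWeight Y z.1 * negWeight Y z.2
  fst_pos := by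
    rw [withDensity_mul_add_map_fst (measurable_posWeight hY) (measurable_posWeight hY)
      posWeight_add_negWeight, hρ.1]
    rfl
  fst_neg := by
    rw [withDensity_mul_add_map_fst (measurable_negWeight hY) (measurable_posWeight hY)
      posWeight_add_negWeight, hρ.1]
    rfl
  snd_pos := by
    rw [withDensity_mul_add_map_snd (measurable_posWeight hY) (measurable_posWeight hY)
      posWeight_add_negWeight, hρ.2]
    rfl
  snd_neg := by
    rw [withDensity_mul_add_map_snd (measurable_negWeight hY) (measurable_posWeight hY)
      posWeight_add_negWeight, hρ.2]
    rfl

theorem neutralPlan_isCanonical (hY : MeasurableSet Y) {m₁ m₂ : Measure X}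
    [IsProbabilityMeasure m₁] [IsProbabilityMeasure m₂] {ρ : Measure (X × X)}
    (hρ : IsCoupling m₁ m₂ ρ) : (neutralPlan hY hρ).IsCanonical := by
  refine ⟨ρ, posWeight Y, negWeight Y, posWeight Y, negWeight Y, ?_, measurable_posWeight hY,
    measurable_negWeight hY, measurable_posWeight hY, measurable_negWeight hY, ?_, ?_, ?_, ?_,
    rfl, rfl, rfl, rfl⟩
  · rwa [neutralize_total, neutralize_total]
  all_goals rw [neutralize_total]; rfl

/-- The part of a probability measure on `X` that is carried by `Y`. -/
noncomputable def SubProb.ofMeasure (hY : MeasurableSet Y) (m : Measure X)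
    [IsProbabilityMeasure m] : SubProb Y :=
  ⟨m.comap Subtype.val, by
    rw [comap_subtype_coe_apply hY]; exact prob_le_one⟩

theorem SubProb.map_ofMeasure (hY : MeasurableSet Y) (m : Measure X) [IsProbabilityMeasure m] :
    (SubProb.ofMeasure hY m).1.map Subtype.val = m.restrict Y := map_comap_subtype_coe hY m

theorem SubProb.eq_ofMeasure (hY : MeasurableSet Y) {m : Measure X} [IsProbabilityMeasure m]
    {μ : SubProb Y} (h : μ.1.map Subtype.val = m.restrict Y) : μ = SubProb.ofMeasure hY m := by
  apply Subtype.ext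
  have he := MeasurableEmbedding.subtype_coe hY
  rw [← he.comap_map μ.1, h, ← SubProb.map_ofMeasure hY m, he.comap_map]

end Neutralize

theorem dStar_le_edist_left {X : Type*} [MetricSpace X] {Y : Set X} {x y : X} (hx : x ∉ Y) :
    dStar Y x y ≤ edist x y :=
  (iInf₂_le x hx).trans_eq (by simp)

theorem dStar_le_edist_right {X : Type*} [MetricSpace X] {Y : Set X} {x y : X} (hy : y ∉ Y) :
    dStar Y x y ≤ edist x y :=
  (iInf₂_le y hy).trans_eq (by simp)

section MassMotion

variable {X : Type*} [MetricSpace X] [MeasurableSpace X] [BorelSpace X] {Y : Set X}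

/-- In the neutral plan, changes of sign occur only at points off `Y`, where they are free, so that
it costs no more than the coupling of which it is the decomposition. -/
theorem neutralPlan_cost_le [SecondCountableTopology X] (hY : MeasurableSet Y) {p : ℝ} (hp : 0 < p)
    {m₁ m₂ : Measure X} [IsProbabilityMeasure m₁] [IsProbabilityMeasure m₂] {ρ : Measure (X × X)}
    (hρ : IsCoupling m₁ m₂ ρ) :
    (neutralPlan hY hρ).cost p ≤ ∫⁻ z, edist z.1 z.2 ^ p ∂ρ := by
  have hu := measurable_posWeight hY
  have hw := measurable_negWeight hY
  have hd : Measurable fun z : X × X => dStar Y z.1 z.2 := measurable_dStar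
  simp only [ChargedPlan.cost, neutralPlan]
  rw [lintegral_withDensity_eq_lintegral_mul _ (by fun_prop) (by fun_prop),
    lintegral_withDensity_eq_lintegral_mul _ (by fun_prop) (by fun_prop),
    lintegral_withDensity_eq_lintegral_mul _ (by fun_prop) (by fun_prop),
    lintegral_withDensity_eq_lintegral_mul _ (by fun_prop) (by fun_prop),
    ← lintegral_add_left (by fun_prop), ← lintegral_add_left (by fun_prop),
    ← lintegral_add_left (by fun_prop)]
  refine lintegral_mono fun z => ?_
  have h1 : posWeight Y z.1 * negWeight Y z.2 * dStar Y z.1 z.2 ^ p ≤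
      posWeight Y z.1 * negWeight Y z.2 * edist z.1 z.2 ^ p := by
    by_cases h : z.2 ∈ Y
    · simp [negWeight, h]
    · gcongr
      exact dStar_le_edist_right h
  have h2 : negWeight Y z.1 * posWeight Y z.2 * dStar Y z.1 z.2 ^ p ≤
      negWeight Y z.1 * posWeight Y z.2 * edist z.1 z.2 ^ p := by
    by_cases h : z.1 ∈ Y
    · simp [negWeight, h]
    · gcongr
      exact dStar_le_edist_left h
  simp only [Pi.mul_apply]
  calc _ ≤ posWeight Y z.1 * posWeight Y z.2 * edist z.1 z.2 ^ p +
        posWeight Y z.1 * negWeight Y z.2 * edist z.1 z.2 ^ p +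
        negWeight Y z.1 * posWeight Y z.2 * edist z.1 z.2 ^ p +
        negWeight Y z.1 * negWeight Y z.2 * edist z.1 z.2 ^ p := by gcongr
    _ = (posWeight Y z.1 + negWeight Y z.1) * (posWeight Y z.2 + negWeight Y z.2) *
        edist z.1 z.2 ^ p := by ring
    _ = _ := by rw [posWeight_add_negWeight, posWeight_add_negWeight, one_mul, one_mul]

/-- Mass that moves in `X` and is invisible off `Y` bounds the pre-distance. -/
theorem wZero_le_of_maps [SecondCountableTopology X] (hY : MeasurableSet Y) (κ : PlanKind) {p : ℝ}
    (hp : 0 < p) {Ω : Type*} [MeasurableSpace Ω] (P : Measure Ω) [IsProbabilityMeasure P]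
    {f g : Ω → X} (hf : Measurable f) (hg : Measurable g) {μ ν : SubProb Y}
    (hμ : μ.1.map Subtype.val = (P.map f).restrict Y)
    (hν : ν.1.map Subtype.val = (P.map g).restrict Y) :
    wZero κ p μ ν ≤ (∫⁻ ω, edist (f ω) (g ω) ^ p ∂P) ^ (1 / p) := by
  have := Measure.isProbabilityMeasure_map (μ := P) hf.aemeasurable
  have := Measure.isProbabilityMeasure_map (μ := P) hg.aemeasurable
  have hc : IsCoupling (P.map f) (P.map g) (P.map fun ω => (f ω, g ω)) := by
    constructor <;> rw [Measure.map_map (by fun_prop) (by fun_prop)] <;> rfl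
  refine iInf₂_le_of_le (neutralize hY (P.map f)) (neutralize hY (P.map g))
    (iInf₂_le_of_le (neutralize_hasEffective hY _ hμ) (neutralize_hasEffective hY _ hν) ?_)
  refine ENNReal.rpow_le_rpow (iInf₂_le_of_le (neutralPlan hY hc) ?_ ?_) (by positivity)
  · cases κ
    · trivial
    · exact neutralPlan_isCanonical hY hc
  · refine (neutralPlan_cost_le hY hp hc).trans_eq ?_
    rw [lintegral_map (by fun_prop) (by fun_prop)]

theorem mem_subProbP_of_map [SecondCountableTopology X] (hY : MeasurableSet Y) (κ : PlanKind)
    {p : ℝ} (hp : 0 < p) {Ω : Type*} [MeasurableSpace Ω] (P : Measure Ω) [IsProbabilityMeasure P]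
    {f : Ω → X} (hf : Measurable f) {μ : SubProb Y}
    (hμ : μ.1.map Subtype.val = (P.map f).restrict Y) (y : Y)
    (hfin : ∫⁻ ω, edist (f ω) y ^ p ∂P ≠ ∞) : μ ∈ subProbP κ p Y := by
  classical
  refine ⟨y, lt_of_le_of_lt (wZero_le_of_maps hY κ hp P hf (measurable_const (a := (y : X))) hμ ?_)
    (ENNReal.rpow_lt_top_of_nonneg (by positivity) hfin)⟩
  rw [Measure.map_const, measure_univ, one_smul, restrict_dirac' hY]
  simp [SubProb.dirac, Measure.map_dirac' measurable_subtype_coe]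

end MassMotion

/-! ### Random paths with jumps off `Y` -/

section RandomPaths

variable {X : Type*} [MetricSpace X] [MeasurableSpace X] [BorelSpace X] {Y : Set X}

/-- A random path in `X` that moves with speed at most `L`, except that it may jump once, at a time
`J / N`, from a point off `Y` to a point off `Y`, yields an upper bound for `W♯_p`. The jumps
are not seen by the measures on `Y`, and they occur at the finitely many times `k / N` only, so that
on each interval between two such times there is none. -/
theorem wSharp_le_of_paths [SecondCountableTopology X] (hY : MeasurableSet Y) (κ : PlanKind) {p : ℝ}
    (hp : 1 ≤ p) {Ω : Type*} [MeasurableSpace Ω] (P : Measure Ω) [IsProbabilityMeasure P]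
    {N : ℕ} (hN : 0 < N) {J : Ω → ℕ} (hJ : Measurable J) {α β : ℝ → Ω → X}
    (hα : ∀ t, Measurable (α t)) (hβ : ∀ t, Measurable (β t)) {L : Ω → ℝ}
    (hαL : ∀ s t ω, dist (α s ω) (α t ω) ≤ L ω * |s - t|)
    (hβL : ∀ s t ω, dist (β s ω) (β t ω) ≤ L ω * |s - t|)
    (hjump : ∀ ω, J ω < N → α (J ω / N) ω ∉ Y ∧ β (J ω / N) ω ∉ Y)
    (hend : ∀ ω, N ≤ J ω → α 1 ω = β 1 ω)
    {μ ν : SubProb Y} (hμ : μ.1.map Subtype.val = (P.map (α 0)).restrict Y)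
    (hν : ν.1.map Subtype.val = (P.map (β 1)).restrict Y) (y : Y)
    (hα0 : ∫⁻ ω, edist (α 0 ω) y ^ p ∂P ≠ ∞) (hβ1 : ∫⁻ ω, edist (β 1 ω) y ^ p ∂P ≠ ∞) :
    wSharp κ p μ ν ≤ (∫⁻ ω, ENNReal.ofReal (L ω) ^ p ∂P) ^ (1 / p) := by
  classical
  have hp0 : 0 < p := by linarith
  have hN' : (0 : ℝ) < N := by exact_mod_cast hN
  by_cases hA : ∫⁻ ω, ENNReal.ofReal (L ω) ^ p ∂P = ∞
  · rw [hA, ENNReal.top_rpow_of_pos (by positivity)]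
    exact le_top
  have hL : ∀ ω, 0 ≤ L ω := fun ω => by simpa using dist_nonneg.trans (hαL 0 1 ω)
  let γ : ℝ → Ω → X := fun t ω => if t ≤ J ω / N then α t ω else β t ω
  have hJm : Measurable fun ω => (J ω : ℝ) := measurable_from_top.comp hJ
  have hγ : ∀ t, Measurable (γ t) := fun t =>
    Measurable.ite (measurableSet_le measurable_const (hJm.div_const _)) (hα t) (hβ t)
  have := fun t => Measure.isProbabilityMeasure_map (μ := P) (hγ t).aemeasurable
  let η : ℝ → SubProb Y := fun t => SubProb.ofMeasure hY (P.map (γ t))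
  have hη : ∀ t, (η t).1.map Subtype.val = (P.map (γ t)).restrict Y := fun t =>
    SubProb.map_ofMeasure hY _
  have h0 : γ 0 = α 0 := by
    ext ω
    exact if_pos (by positivity)
  have h1 : γ 1 = β 1 := by
    ext ω
    by_cases h : (1 : ℝ) ≤ J ω / N
    · simp only [γ, if_pos h]
      exact hend ω (by rw [one_le_div hN'] at h; exact_mod_cast h)
    · simp only [γ, if_neg h]
  have hη0 : μ = η 0 := SubProb.eq_ofMeasure hY (by rw [h0]; exact hμ)
  have hη1 : ν = η 1 := SubProb.eq_ofMeasure hY (by rw [h1]; exact hν)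
  rw [hη0, hη1]
  have hedist : ∀ {x x' : X} {ω : Ω} {s t : ℝ}, dist x x' ≤ L ω * |s - t| →
      edist x x' ≤ ENNReal.ofReal (L ω) * ENNReal.ofReal |s - t| := by
    intro x x' ω s t h
    rw [edist_dist, ← ENNReal.ofReal_mul (hL ω)]
    exact ENNReal.ofReal_le_ofReal h
  have hmem : ∀ t ∈ Icc (0 : ℝ) 1, η t ∈ subProbP κ p Y := by
    intro t ht
    refine mem_subProbP_of_map hY κ hp0 P (hγ t) (hη t) y ?_
    have hfin := ENNReal.lintegral_rpow_add_lt_top_of_lintegral_rpow_lt_top (μ := P)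
      (f := fun ω => edist (α 0 ω) (y : X) + edist (β 1 ω) y)
      (((hα 0).edist measurable_const).add ((hβ 1).edist measurable_const)).aemeasurable
      (ENNReal.lintegral_rpow_add_lt_top_of_lintegral_rpow_lt_top
        ((hα 0).edist measurable_const).aemeasurable hα0.lt_top hβ1.lt_top hp)
      (g := fun ω => ENNReal.ofReal (L ω)) (lt_top_iff_ne_top.2 hA) hp
    refine ne_top_of_le_ne_top hfin.ne (lintegral_mono fun ω => ?_)
    refine ENNReal.rpow_le_rpow ?_ hp0.le
    simp only [Pi.add_apply]
    have hle : ∀ s : ℝ, |t - s| ≤ 1 →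
        ENNReal.ofReal (L ω) * ENNReal.ofReal |t - s| ≤ ENNReal.ofReal (L ω) := fun s hs =>
      mul_le_of_le_one_right' (by simpa using hs)
    simp only [γ]
    split_ifs
    · calc edist (α t ω) y ≤ edist (α t ω) (α 0 ω) + edist (α 0 ω) y := edist_triangle _ _ _
        _ ≤ ENNReal.ofReal (L ω) + edist (α 0 ω) y := by
          gcongr
          exact (hedist (hαL t 0 ω)).trans
            (hle 0 (abs_le.2 ⟨by linarith [ht.1], by linarith [ht.2]⟩))
        _ ≤ ENNReal.ofReal (L ω) + edist (α 0 ω) y + edist (β 1 ω) y := le_self_add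
        _ = _ := by ring
    · calc edist (β t ω) y ≤ edist (β t ω) (β 1 ω) + edist (β 1 ω) y := edist_triangle _ _ _
        _ ≤ ENNReal.ofReal (L ω) + edist (β 1 ω) y := by
          gcongr
          exact (hedist (hβL t 1 ω)).trans
            (hle 1 (abs_le.2 ⟨by linarith [ht.1], by linarith [ht.2]⟩))
        _ ≤ ENNReal.ofReal (L ω) + edist (β 1 ω) y + edist (α 0 ω) y := le_self_add
        _ = _ := by ring
  refine wSharp_le_of_lipschitz (η := η) (ENNReal.rpow_ne_top_of_nonneg (by positivity) hA) hmem
    (wFlat_le_of_piecewise hmem (fun k hk s hs t ht => ?_) hN)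
  -- the version of the path without a jump between `k / N` and `(k + 1) / N`
  let γ' : ℝ → Ω → X := fun t ω => if k < J ω then α t ω else β t ω
  have hγ' : ∀ t, Measurable (γ' t) := fun t =>
    Measurable.ite (measurableSet_lt measurable_const hJ) (hα t) (hβ t)
  have hγγ' : ∀ t ∈ Icc (k / N : ℝ) ((k + 1) / N), ∀ ω,
      γ t ω = γ' t ω ∨ γ t ω ∉ Y ∧ γ' t ω ∉ Y := by
    intro t ht ω
    rcases lt_trichotomy k (J ω) with h | h | h
    · left
      have : t ≤ J ω / N := ht.2.trans (by gcongr; exact_mod_cast h)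
      simp only [γ, γ', if_pos h, if_pos this]
    · by_cases ht' : t ≤ J ω / N
      · right
        have hte : t = J ω / N := le_antisymm ht' (h ▸ ht.1)
        have hj := hjump ω (h ▸ hk)
        simp only [γ, γ', if_pos ht', h, lt_irrefl, if_false]
        rw [hte]
        exact hj
      · left
        simp only [γ, γ', if_neg ht', h, lt_irrefl, if_false]
    · left
      have : ¬ t ≤ J ω / N := not_le.2 (lt_of_lt_of_le (by gcongr) ht.1)
      simp only [γ, γ', if_neg this, if_neg h.le.not_gt]
  have hη' : ∀ t ∈ Icc (k / N : ℝ) ((k + 1) / N),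
      (η t).1.map Subtype.val = (P.map (γ' t)).restrict Y := by
    intro t ht
    rw [hη]
    ext S hS
    rw [Measure.restrict_apply hS, Measure.restrict_apply hS,
      Measure.map_apply (hγ t) (hS.inter hY), Measure.map_apply (hγ' t) (hS.inter hY)]
    congr 1
    ext ω
    rcases hγγ' t ht ω with h | h
    · simp only [mem_preimage, h]
    · simp only [mem_preimage, mem_inter_iff, h.1, h.2, and_false]
  refine (wZero_le_of_maps hY κ hp0 P (hγ' s) (hγ' t) (hη' s hs) (hη' t ht)).trans ?_
  calc (∫⁻ ω, edist (γ' s ω) (γ' t ω) ^ p ∂P) ^ (1 / p)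
      ≤ (∫⁻ ω, ENNReal.ofReal (L ω) ^ p * ENNReal.ofReal |s - t| ^ p ∂P) ^ (1 / p) := by
        gcongr with ω
        rw [← ENNReal.mul_rpow_of_nonneg _ _ hp0.le]
        gcongr
        simp only [γ']
        split_ifs
        exacts [hedist (hαL s t ω), hedist (hβL s t ω)]
    _ = _ := by
        rw [lintegral_mul_const' _ _ (by finiteness),
          ENNReal.mul_rpow_of_nonneg _ _ (by positivity), ← ENNReal.rpow_mul,
          mul_one_div_cancel hp0.ne', ENNReal.rpow_one]

end RandomPaths

/-! ### The upper bound by couplings on the completion -/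

section UpperBound

variable {X : Type*} [MetricSpace X] [MeasurableSpace X] [BorelSpace X] {Y : Set X}

open Completion'

theorem SubProb.HasMoment.of_base [SecondCountableTopology X] {p : ℝ} (hp : 1 ≤ p) {μ : SubProb Y}
    {y y' : X} (h : μ.HasMoment p y) : μ.HasMoment p y' := by
  have hconst : ∫⁻ _ : Y, edist y y' ^ p ∂μ.1 < ∞ := by
    rw [lintegral_const]
    have := ne_top_of_le_ne_top ENNReal.one_ne_top μ.2
    have := edist_ne_top y y'
    exact ENNReal.mul_lt_top (by finiteness) (by finiteness)
  have h1 := ENNReal.lintegral_rpow_add_lt_top_of_lintegral_rpow_lt_top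
    (f := fun x : Y => edist (x : X) y) (g := fun _ => edist y y') (by fun_prop)
    (lt_top_iff_ne_top.2 h) hconst hp
  refine ne_top_of_le_ne_top h1.ne (lintegral_mono fun x => ?_)
  exact ENNReal.rpow_le_rpow (edist_triangle _ _ _) (by linarith)

variable [CompleteSpace X] [TopologicalSpace.SeparableSpace X]

theorem SubProb.restrict_map_toAmbient_extend (hY : IsOpen Y) {z₀ : X} (hz₀ : z₀ ∉ Y)
    (μ : SubProb Y) : (μ.extend.map (toAmbient Y z₀)).restrict Y = μ.1.map Subtype.val := by
  classical
  have hm := measurable_toAmbient hY hz₀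
  rw [SubProb.extend, Measure.map_add _ _ hm, Measure.map_smul, Measure.map_dirac' hm,
    Measure.map_map hm continuous_pt.measurable, Measure.restrict_add, Measure.restrict_smul,
    restrict_dirac' hY.measurableSet, if_neg (show toAmbient Y z₀ cemetery ∉ Y from hz₀),
    smul_zero, add_zero]
  exact Measure.restrict_eq_self_of_ae_mem ((ae_map_iff
    measurable_subtype_coe.aemeasurable hY.measurableSet).2 (ae_of_all _ fun x => x.2))

theorem lintegral_toAmbient_ne_top (hY : IsOpen Y) {z₀ : X} (hz₀ : z₀ ∉ Y) {p : ℝ} (hp : 1 ≤ p)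
    {μ : SubProb Y} {y : X} (h : μ.HasMoment p y) :
    ∫⁻ a, edist (toAmbient Y z₀ a) y ^ p ∂μ.extend ≠ ∞ := by
  have := UniformSpace.secondCountable_of_separable X
  have hm := measurable_toAmbient hY hz₀
  have hm' : Measurable fun a : Completion' Y => edist (toAmbient Y z₀ a) y ^ p := by fun_prop
  rw [SubProb.extend, lintegral_add_measure, lintegral_smul_measure, lintegral_dirac' _ hm',
    lintegral_map hm' continuous_pt.measurable]
  refine ENNReal.add_ne_top.2 ⟨h, ENNReal.mul_ne_top (by finiteness) ?_⟩
  exact ENNReal.rpow_ne_top_of_nonneg (by linarith) (edist_ne_top _ _)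

/-- The speed of the first part of a path via `∂` whose jump time is a multiple of `1 / N`. -/
theorem speed_before_jump {K a b d : ℝ} {N J : ℕ} (hK : 1 < K) (ha : 0 ≤ a) (hb : 0 ≤ b)
    (hd : d ≤ K * a) (hN : (N : ℝ) ≤ K * (N - 1)) (hJ : a * (N - 1) ≤ J * (a + b)) (s t : ℝ) :
    K * d * |N * s / J - N * t / J| ≤ K ^ 3 * (a + b) * |s - t| := by
  have hK0 : 0 < K := by linarith
  rcases Nat.eq_zero_or_pos J with rfl | hJ0
  · simp only [Nat.cast_zero, div_zero, sub_zero, abs_zero, mul_zero]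
    positivity
  have hJ' : (0 : ℝ) < J := by exact_mod_cast hJ0
  rw [← sub_div, ← mul_sub, abs_div, abs_mul, abs_of_pos hJ', Nat.abs_cast]
  have h1 : d * N ≤ K ^ 2 * (a + b) * J := by
    calc d * N ≤ K * a * (K * (N - 1)) := by gcongr
      _ = K ^ 2 * (a * (N - 1)) := by ring
      _ ≤ K ^ 2 * (J * (a + b)) := by gcongr
      _ = _ := by ring
  calc K * d * (N * |s - t| / J) = K * (d * N) * |s - t| / J := by ring
    _ ≤ K * (K ^ 2 * (a + b) * J) * |s - t| / J := by gcongr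
    _ = _ := by field_simp

/-- A coupling of the extended measures gives an upper bound for `W♯_p`: a particle that uses the
shortcut runs to a nearly closest point off `Y`, jumps, and then runs to its target. -/
theorem wSharp_le_of_coupling (hX : IsLengthSpace X) (hY : IsOpen Y) (hYne : Y.Nonempty)
    (hne : Y ≠ univ) {κ : PlanKind} {p : ℝ} (hp : 1 ≤ p) {μ ν : SubProb Y}
    (hμ : μ ∈ subProbP κ p Y) (hν : ν ∈ subProbP κ p Y)
    {q : Measure (Completion' Y × Completion' Y)} (hq : IsCoupling μ.extend ν.extend q)
    {K : ℝ} (hK : 1 < K) :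
    wSharp κ p μ ν ≤ ENNReal.ofReal (K ^ 3) * (∫⁻ z, edist z.1 z.2 ^ p ∂q) ^ (1 / p) := by
  classical
  have hK0 : 0 < K := by linarith
  have hp0 : 0 < p := by linarith
  have := UniformSpace.secondCountable_of_separable X
  have := secondCountableTopology (Y := Y) hne
  obtain ⟨z₀, hz₀⟩ := nonempty_compl.2 hne
  obtain ⟨y₀, hy₀⟩ := hYne
  obtain ⟨y₁, hμy⟩ := exists_hasMoment_of_mem_subProbP hp hμ
  obtain ⟨y₂, hνy⟩ := exists_hasMoment_of_mem_subProbP hp hν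
  have hqP : IsProbabilityMeasure q := ⟨by
    rw [← preimage_univ (f := Prod.fst), ← Measure.map_apply measurable_fst .univ, hq.1,
      SubProb.extend_univ]⟩
  obtain ⟨path, hpm, hp_le, hp_ge, hpd⟩ := hX.exists_measurable_path hK
  obtain ⟨foot, hfm, hf⟩ := exists_measurable_foot hY.isClosed_compl ⟨z₀, hz₀⟩ hK
  obtain ⟨N, hN1, hN⟩ : ∃ N : ℕ, 1 < N ∧ (N : ℝ) ≤ K * (N - 1) := by
    obtain ⟨n, hn⟩ := exists_nat_ge (1 / (K - 1))
    rw [div_le_iff₀ (by linarith)] at hn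
    refine ⟨n + 1, ?_, ?_⟩
    · rcases Nat.eq_zero_or_pos n with rfl | h
      · norm_num at hn
      · omega
    · push_cast
      linarith
  have hN0 : 0 < N := by omega
  have hN1' : (0 : ℝ) < (N : ℝ) - 1 := by
    rw [sub_pos]; exact_mod_cast hN1
  have hm := measurable_toAmbient hY hz₀
  let x : Completion' Y × Completion' Y → X := fun z => toAmbient Y z₀ z.1
  let y : Completion' Y × Completion' Y → X := fun z => toAmbient Y z₀ z.2
  let a : Completion' Y × Completion' Y → ℝ := fun z => distCemetery z.1
  let b : Completion' Y × Completion' Y → ℝ := fun z => distCemetery z.2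
  have hx : Measurable x := hm.comp measurable_fst
  have hy : Measurable y := hm.comp measurable_snd
  have ha : Measurable a := continuous_distCemetery.measurable.comp measurable_fst
  have hb : Measurable b := continuous_distCemetery.measurable.comp measurable_snd
  have ha0 : ∀ z, 0 ≤ a z := fun z => distCemetery_nonneg _
  have hb0 : ∀ z, 0 ≤ b z := fun z => distCemetery_nonneg _
  have hxa : ∀ z, Metric.infDist (x z) Yᶜ = a z := fun z => by
    rw [← distCemetery_collapse, collapse_toAmbient hz₀]
  have hyb : ∀ z, Metric.infDist (y z) Yᶜ = b z := fun z => by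
    rw [← distCemetery_collapse, collapse_toAmbient hz₀]
  -- the pairs between which the direct way is not longer than the way via `∂`
  let S : Set (Completion' Y × Completion' Y) := {z | dist (x z) (y z) ≤ a z + b z}
  have hS : MeasurableSet S := measurableSet_le (hx.dist hy) (ha.add hb)
  -- the jump time `a / (a + b)` of a path of constant speed, rounded to a multiple of `1 / N`
  let r : Completion' Y × Completion' Y → ℝ := fun z => a z / (a z + b z) * (N - 1)
  let J : Completion' Y × Completion' Y → ℕ := fun z => if z ∈ S then N else ⌈r z⌉₊
  have hJ : Measurable J :=
    Measurable.ite hS measurable_const (Nat.measurable_ceil.comp ((ha.div (ha.add hb)).mul_const _))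
  have hr0 : ∀ z, 0 ≤ r z := fun z =>
    mul_nonneg (div_nonneg (ha0 z) (add_nonneg (ha0 z) (hb0 z))) hN1'.le
  have hrab : ∀ z, r z * (a z + b z) = a z * (N - 1) := fun z => by
    rcases (add_nonneg (ha0 z) (hb0 z)).eq_or_lt with h | h
    · have : a z = 0 := by linarith [ha0 z, hb0 z]
      rw [← h, this]; ring
    · simp only [r]; field_simp
  have hJlt : ∀ z, z ∉ S → J z < N := fun z hz => by
    have hr1 : r z ≤ (N - 1 : ℕ) := by
      rw [Nat.cast_sub hN0, Nat.cast_one]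
      exact mul_le_of_le_one_left hN1'.le (div_le_one_of_le₀ (by linarith [hb0 z])
        (add_nonneg (ha0 z) (hb0 z)))
    have h : ⌈r z⌉₊ ≤ N - 1 := Nat.ceil_le.2 hr1
    simp only [J, if_neg hz]
    omega
  have hJ1 : ∀ z, z ∉ S → a z * (N - 1) ≤ J z * (a z + b z) := fun z hz => by
    rw [← hrab]
    simp only [J, if_neg hz]
    exact mul_le_mul_of_nonneg_right (Nat.le_ceil _) (add_nonneg (ha0 z) (hb0 z))
  have hJ2 : ∀ z, z ∉ S → b z * (N - 1) ≤ (N - J z : ℕ) * (b z + a z) := fun z hz => by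
    have h : (J z : ℝ) ≤ r z + 1 := by
      simp only [J, if_neg hz]
      exact (Nat.ceil_lt_add_one (hr0 z)).le
    rw [Nat.cast_sub (hJlt z hz).le]
    have := mul_le_mul_of_nonneg_right h (add_nonneg (ha0 z) (hb0 z))
    have := hrab z
    nlinarith
  let α : ℝ → Completion' Y × Completion' Y → X := fun t z =>
    if z ∈ S then path t (x z, y z) else path (N * t / J z) (x z, foot (x z))
  let β : ℝ → Completion' Y × Completion' Y → X := fun t z =>
    if z ∈ S then path t (x z, y z) else
      path (N * (t - J z / N) / (N - J z : ℕ)) (foot (y z), y z)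
  have hcount : ∀ (c : ℕ → ℝ) {u v : Completion' Y × Completion' Y → X}, Measurable u →
      Measurable v → Measurable fun z => path (c (J z)) (u z, v z) := by
    intro c u v hu hv
    have h : Measurable fun w : (X × X) × ℕ => path (c w.2) w.1 :=
      measurable_from_prod_countable_left fun j => hpm (c j)
    exact h.comp ((hu.prodMk hv).prodMk hJ)
  have hα : ∀ t, Measurable (α t) := fun t =>
    Measurable.ite hS ((hpm t).comp (hx.prodMk hy))
      (hcount (fun j => N * t / j) hx (hfm.comp hx))
  have hβ : ∀ t, Measurable (β t) := fun t =>
    Measurable.ite hS ((hpm t).comp (hx.prodMk hy))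
      (hcount (fun j => N * (t - j / N) / (N - j : ℕ)) (hfm.comp hy) hy)
  have hdist : ∀ z : Completion' Y × Completion' Y,
      dist z.1 z.2 = min (dist (x z) (y z)) (a z + b z) := fun z => dist_eq_min z₀ hz₀ z.1 z.2
  have hdS : ∀ z ∈ S, dist z.1 z.2 = dist (x z) (y z) := fun z hz => by
    rw [hdist]; exact min_eq_left hz
  have hdS' : ∀ z, z ∉ S → dist z.1 z.2 = a z + b z := fun z hz => by
    rw [hdist]; exact min_eq_right (not_le.1 hz).le
  have hKK : K ≤ K ^ 3 := by nlinarith [mul_pos hK0 hK0]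
  have hdirect : ∀ s t z, z ∈ S → dist (path s (x z, y z)) (path t (x z, y z)) ≤
      K ^ 3 * dist z.1 z.2 * |s - t| := fun s t z hz => by
    rw [hdS z hz]
    exact (hpd s t (x z, y z)).trans (by gcongr)
  have hα0 : α 0 = x := by
    ext z
    simp only [α, mul_zero, zero_div]
    split_ifs
    exacts [hp_le 0 le_rfl _, hp_le 0 le_rfl _]
  have hβ1 : β 1 = y := by
    ext z
    simp only [β]
    split_ifs with hz
    · exact hp_ge 1 le_rfl _
    · refine hp_ge _ (le_of_eq ?_) _
      have h1 : (0 : ℝ) < N - J z := by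
        rw [sub_pos]; exact_mod_cast hJlt z hz
      have h2 : (0 : ℝ) < N := by exact_mod_cast hN0
      rw [Nat.cast_sub (hJlt z hz).le]
      field_simp
  have hmain := wSharp_le_of_paths hY.measurableSet κ hp q hN0 hJ hα hβ
    (L := fun z => K ^ 3 * dist z.1 z.2) (μ := μ) (ν := ν) ?_ ?_ ?_ ?_ ?_ ?_ ⟨y₀, hy₀⟩ ?_ ?_
  · refine hmain.trans_eq ?_
    have hK3 : 0 ≤ K ^ 3 := by positivity
    simp_rw [ENNReal.ofReal_mul hK3, ← edist_dist, ENNReal.mul_rpow_of_nonneg _ _ hp0.le]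
    rw [lintegral_const_mul' _ _ (by finiteness), ENNReal.mul_rpow_of_nonneg _ _ (by positivity),
      ← ENNReal.rpow_mul, mul_one_div_cancel hp0.ne', ENNReal.rpow_one]
  · intro s t z
    simp only [α]
    split_ifs with hz
    · exact hdirect s t z hz
    · rw [hdS' z hz]
      refine (hpd _ _ _).trans ?_
      exact speed_before_jump hK (ha0 z) (hb0 z) (hxa z ▸ (hf (x z)).2) hN (hJ1 z hz) s t
  · intro s t z
    simp only [β]
    split_ifs with hz
    · exact hdirect s t z hz
    · rw [hdS' z hz]
      refine (hpd _ _ _).trans ?_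
      have hd : dist (foot (y z)) (y z) ≤ K * b z := by
        rw [dist_comm, ← hyb z]; exact (hf (y z)).2
      have h := speed_before_jump hK (hb0 z) (ha0 z) hd hN (hJ2 z hz) (s - J z / N) (t - J z / N)
      rwa [sub_sub_sub_cancel_right, add_comm (b z)] at h
  · intro z hz
    have hzS : z ∉ S := fun h => by simp [J, h] at hz
    have h2 : (N : ℝ) ≠ 0 := by exact_mod_cast hN0.ne'
    simp only [α, β, if_neg hzS]
    constructor
    · rcases Nat.eq_zero_or_pos (J z) with h | h
      · -- no time is spent before the jump only if the particle starts off `Y`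
        rw [h, Nat.cast_zero, div_zero, hp_le 0 le_rfl]
        have h1 := hJ1 z hzS
        rw [h, Nat.cast_zero, zero_mul] at h1
        have h3 : a z = 0 := le_antisymm (nonpos_of_mul_nonpos_left h1 hN1') (ha0 z)
        exact (hY.isClosed_compl.mem_iff_infDist_zero ⟨z₀, hz₀⟩).2 ((hxa z).trans h3)
      · rw [mul_div_cancel₀ _ h2, div_self (by exact_mod_cast h.ne'), hp_ge 1 le_rfl]
        exact (hf (x z)).1
    · rw [sub_self, mul_zero, zero_div, hp_le 0 le_rfl]
      exact (hf (y z)).1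
  · intro z hz
    have hzS : z ∈ S := by
      by_contra h
      exact absurd (hJlt z h) (not_lt.2 hz)
    simp only [α, β, if_pos hzS]
  · rw [hα0, ← SubProb.restrict_map_toAmbient_extend hY hz₀ μ, ← hq.1,
      Measure.map_map hm measurable_fst]
    rfl
  · rw [hβ1, ← SubProb.restrict_map_toAmbient_extend hY hz₀ ν, ← hq.2,
      Measure.map_map hm measurable_snd]
    rfl
  · rw [hα0]
    have h := lintegral_toAmbient_ne_top hY hz₀ hp (hμy.of_base hp (y' := y₀))
    rwa [← hq.1, lintegral_map (by fun_prop) measurable_fst] at h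
  · rw [hβ1]
    have h := lintegral_toAmbient_ne_top hY hz₀ hp (hνy.of_base hp (y' := y₀))
    rwa [← hq.2, lintegral_map (by fun_prop) measurable_snd] at h

theorem wSharp_le_wPrime (hX : IsLengthSpace X) (hY : IsOpen Y) (hYne : Y.Nonempty)
    (hne : Y ≠ univ) {κ : PlanKind} {p : ℝ} (hp : 1 ≤ p) {μ ν : SubProb Y}
    (hμ : μ ∈ subProbP κ p Y) (hν : ν ∈ subProbP κ p Y) : wSharp κ p μ ν ≤ wPrime p μ ν := by
  have hp0 : 0 < p := by linarith
  rw [wPrime, wasserstein, one_div, ENNReal.le_rpow_inv_iff hp0]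
  refine le_iInf₂ fun q hq => ?_
  rw [← ENNReal.le_rpow_inv_iff hp0, ← one_div]
  have hlim : Tendsto (fun K : ℝ => ENNReal.ofReal (K ^ 3) *
      (∫⁻ z, edist z.1 z.2 ^ p ∂q) ^ (1 / p)) (𝓝[>] 1)
      (𝓝 (ENNReal.ofReal (1 ^ 3) * (∫⁻ z, edist z.1 z.2 ^ p ∂q) ^ (1 / p))) := by
    refine ENNReal.Tendsto.mul_const ?_ (Or.inl (by simp))
    exact ((ENNReal.continuous_ofReal.comp (continuous_pow 3)).tendsto 1).mono_left
      nhdsWithin_le_nhds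
  rw [one_pow, ENNReal.ofReal_one, one_mul] at hlim
  exact ge_of_tendsto hlim (eventually_mem_nhdsWithin.mono fun K hK =>
    wSharp_le_of_coupling hX hY hYne hne hp hμ hν hq hK)

end UpperBound

theorem theorem1p7 {X : Type*} [MetricSpace X] [CompleteSpace X]
    [TopologicalSpace.SeparableSpace X] [MeasurableSpace X] [BorelSpace X]
    (hX : IsLengthSpace X) (Y : Set X) (hYopen : IsOpen Y) (hYne : Y.Nonempty)
    (hYuniv : Y ≠ Set.univ) (κ : PlanKind) :
    (∀ μ ∈ subProbP κ 1 Y, ∀ ν ∈ subProbP κ 1 Y,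
      wFlat κ 1 μ ν = wSharp κ 1 μ ν ∧ wSharp κ 1 μ ν = wPrime 1 μ ν) ∧
    (∀ p : ℝ, 1 ≤ p → ∀ μ ∈ subProbP κ p Y, ∀ ν ∈ subProbP κ p Y,
      wPrime 1 μ ν ≤ wFlat κ p μ ν ∧ wFlat κ p μ ν ≤ wSharp κ p μ ν ∧
        wSharp κ p μ ν ≤ wPrime p μ ν) := by
  have main : ∀ p : ℝ, 1 ≤ p → ∀ μ ∈ subProbP κ p Y, ∀ ν ∈ subProbP κ p Y,
      wPrime 1 μ ν ≤ wFlat κ p μ ν ∧ wFlat κ p μ ν ≤ wSharp κ p μ ν ∧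
        wSharp κ p μ ν ≤ wPrime p μ ν := fun p hp μ hμ ν hν =>
    ⟨wPrime_one_le_wFlat hYopen hYuniv hp μ ν, wFlat_le_wSharp μ ν,
      wSharp_le_wPrime hX hYopen hYne hYuniv hp hμ hν⟩
  refine ⟨fun μ hμ ν hν => ?_, main⟩
  obtain ⟨h1, h2, h3⟩ := main 1 le_rfl μ hμ ν hν
  exact ⟨le_antisymm h2 (h3.trans h1), le_antisymm h3 (h1.trans h2)⟩
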